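/- **Setting.** There are $K$ arms and $T$ rounds. In round $t$ the environment fixes a loss vector $\ell_t\in[0,1]^K$ without knowledge of the learner's draws (oblivious adversary); the learner draws an arm $I_t$ and observes only $\ell_{t,I_t}$. The pseudo-regret is $R_T=\max_{a\in[K]}\mathbb E\big[\sum_{t=1}^T(\ell_{t,I_t}-\ell_{t,a})\big]$, the expectation being over all randomness. For a fixed loss sequence put $Q_\infty=\min_{\bar\ell\in[0,1]^K}\sum_{t=1}^T\|\ell_t-\bar\ell\|_\infty^2$ and $L^*=\min_{i\in[K]}\sum_{t=1}^T\ell_{t,i}$. **Algorithm (coordinate-wise SPM with parameter $\alpha\in(0,1)$).** Put $\gamma=\max\big(6,48\sqrt{\alpha/(1-\alpha)}\big)$, $d=2$, $\beta_{1,i}=\frac{8K}{1-\alpha}$ and $L_{0,i}=0$ for all $i\in[K]$. In each round $t=1,\dots,T$: 1. $m_{t,i}=\dfrac{\frac12+\sum_{s<t}\mathbf 1\{I_s=i\}\,\ell_{s,i}}{1+\sum_{s<t}\mathbf 1\{I_s=i\}}$ for $i\in[K]$; 2. $q_t=\arg\min_x\ \langle m_t+L_{t-1},x\rangle+\sum_{i=1}^K\beta_{t,i}\Big(-\frac{x_i^\alpha}{\alpha}+(1-x_i)\ln(1-x_i)+x_i\Big)-\gamma\sum_{i=1}^K\ln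 x_i$ over the probability simplex in $\mathbb R^K$; 3. $p_t=(1-\frac KT)q_t+\frac1T\mathbf 1$; draw $I_t\sim p_t$ and observe $\ell_{t,I_t}$; 4. $L_{t,i}=L_{t-1,i}+m_{t,i}+\dfrac{(\ell_{t,i}-m_{t,i})\mathbf 1\{I_t=i\}}{p_{t,i}}$; 5. $z_{t,i}=\mathbf 1\{I_t=i\}(\ell_{t,i}-m_{t,i})^2\min\Big(\frac{(6d)^{2-\alpha}}{2(1-\alpha)}\min\big\{p_{t,i}^{-\alpha},\frac{1-p_{t,i}}{p_{t,i}^2}\big\},\ \frac{18d^2\beta_{t,i}}{\gamma}\Big)$, $\ h_{t,i}=\frac1\alpha p_{t,i}^\alpha$, $\ \beta_{t+1,i}=\beta_{t,i}+\dfrac{z_{t,i}}{\beta_{t,i}h_{t,i}}$. **Theorem.** There is a universal constant $C>0$ such that for all $\alpha\in(0,1)$, $K\ge4$ and $T\ge4K$, coordinate-wise SPM satisfies both of the following. * *Adversarial regime.* For every sequence $\ell_1,\dots,\ell_T\in[0,1]^K$, $$R_T\le\frac{C}{\alpha(1-\alpha)}\min\Big\{\sqrt{K\ln(T)\min(Q_\infty,L^*,T-L^*)}+K\ln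 T+K^{2-\alpha},\ \ K^{\alpha/2}\sqrt{KT}+K^{2-\alpha}\Big\}.$$ * *Stochastic regime.* Let $\ell_1,\dots,\ell_T$ be i.i.d. with an arbitrary law on $[0,1]^K$, and suppose that there is an arm $i^*$ with $\Delta_i=\mathbb E[\ell_{1,i}]-\mathbb E[\ell_{1,i^*}]>0$ for all $i\ne i^*$. Then, the expectation defining $R_T$ being that of an integrable random variable, $$R_T\le\frac{C}{\alpha(1-\alpha)}\Big(\sum_{i\ne i^*}\frac{\ln T}{\Delta_i}+K^{2-\alpha}\Big).$$ -/

import Mathlib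

open MeasureTheory

noncomputable section

namespace Bandit

/-! ### Multi-armed bandits with `K` arms, `T` rounds and an oblivious adversary

Arms are `Fin K`, rounds are `Fin T` (round `t` of the text is index `t - 1`), and `ℓ t i` is the
loss of arm `i` in round `t`. -/

/-- A randomized bandit policy: it sees the list of past pairs (drawn arm, observed loss), oldest
first, and returns the probabilities with which the next arm is drawn. -/
abbrev Policy (K : ℕ) := List (Fin K × ℝ) → Fin K → ℝ

/-- What the learner has seen before round `t` when the losses are `ℓ` and the drawn arms `I`. -/
def history {K T : ℕ} (ℓ : Fin T → Fin K → ℝ) (I : Fin T → Fin K) (t : Fin T) :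
    List (Fin K × ℝ) :=
  ((List.finRange T).take t).map fun s => (I s, ℓ s (I s))

/-- The probability that the sequence of drawn arms is `I`, for the fixed losses `ℓ`. -/
def trajProb {K T : ℕ} (π : Policy K) (ℓ : Fin T → Fin K → ℝ) (I : Fin T → Fin K) : ℝ :=
  ∏ t, π (history ℓ I t) (I t)

/-- `𝔼 [∑ₜ (ℓ t (I t) - ℓ t a)]`, the expectation being over the draws of the policy. -/
def regretAgainst {K T : ℕ} (π : Policy K) (ℓ : Fin T → Fin K → ℝ) (a : Fin K) : ℝ :=
  ∑ I : Fin T → Fin K, trajProb π ℓ I * ∑ t, (ℓ t (I t) - ℓ t a)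

/-- The pseudo-regret for a fixed (oblivious) loss sequence. -/
def pseudoRegret {K T : ℕ} (π : Policy K) (ℓ : Fin T → Fin K → ℝ) : ℝ :=
  ⨆ a, regretAgainst π ℓ a

/-- The pseudo-regret when the loss vectors of the `T` rounds are i.i.d. with law `ν`; the
expectation is over the losses and the draws of the policy. -/
def stochasticRegret {K : ℕ} (T : ℕ) (π : Policy K) (ν : Measure (Fin K → ℝ)) : ℝ :=
  ⨆ a, ∫ ℓ, regretAgainst π ℓ a ∂(Measure.pi fun _ : Fin T => ν)

/-- The gap of arm `i` with respect to arm `j`: the difference of the mean losses. -/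
def gap {K : ℕ} (ν : Measure (Fin K → ℝ)) (j i : Fin K) : ℝ :=
  (∫ x, x i ∂ν) - ∫ x, x j ∂ν

/-- The total variation `Q_∞` in the norm `ℓ_∞` (the norm of `Fin K → ℝ` is the sup norm). -/
def supVariation {K T : ℕ} (ℓ : Fin T → Fin K → ℝ) : ℝ :=
  ⨅ m : Set.Icc (0 : Fin K → ℝ) 1, ∑ t, ‖ℓ t - m‖ ^ 2

/-- The cumulative loss `L*` of the best arm. -/
def bestArmLoss {K T : ℕ} (ℓ : Fin T → Fin K → ℝ) : ℝ :=
  ⨅ i, ∑ t, ℓ t i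

/-! ### Coordinate-wise stability-penalty matching -/

/-- What the algorithm remembers at the beginning of a round. -/
@[ext] structure CoWSPMState (K : ℕ) where
  /-- the cumulative loss estimates `L_{t-1}` -/
  cumEst : Fin K → ℝ
  /-- the learning rates `β_t` -/
  rate : Fin K → ℝ
  /-- the number of earlier rounds in which each arm was drawn -/
  count : Fin K → ℕ
  /-- the sum of the losses observed so far on each arm -/
  lossSum : Fin K → ℝ

namespace CoWSPM

variable {K : ℕ}

/-- The coefficient `γ` of the log-barrier. -/
def barrier (α : ℝ) : ℝ := max 6 (48 * √(α / (1 - α)))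

/-- The parameter `d`. -/
def dParam : ℝ := 2

/-- The state before the first round. -/
def start (K : ℕ) (α : ℝ) : CoWSPMState K where
  cumEst _ := 0
  rate _ := 8 * K / (1 - α)
  count _ := 0
  lossSum _ := 0

/-- The optimistic prediction `m_t` of the loss vector. -/
def prediction (s : CoWSPMState K) (i : Fin K) : ℝ :=
  (1 / 2 + s.lossSum i) / (1 + s.count i)

/-- The hybrid regularizer `φ_t`: Tsallis entropy, partial Shannon entropy with a linear term, and
log-barrier. -/
def regularizer (α : ℝ) (β : Fin K → ℝ) (x : Fin K → ℝ) : ℝ :=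
  ∑ i, β i * (-(x i ^ α) / α + (1 - x i) * Real.log (1 - x i) + x i)
    - barrier α * ∑ i, Real.log (x i)

/-- The probability vectors with positive entries. The log-barrier is `+∞` at all others, so that
minimizing over this set is the same as minimizing over the whole simplex. -/
def openSimplex (K : ℕ) : Set (Fin K → ℝ) :=
  {x | x ∈ stdSimplex ℝ (Fin K) ∧ ∀ i, 0 < x i}

/-- The optimistic FTRL objective `⟨m_t + L_{t-1}, x⟩ + φ_t(x)`. -/
def objective (α : ℝ) (s : CoWSPMState K) (x : Fin K → ℝ) : ℝ :=
  ∑ i, (prediction s i + s.cumEst i) * x i + regularizer α s.rate x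

/-- The optimistic FTRL iterate `q_t`, the minimizer of the objective over the simplex (the
objective is strictly convex for positive rates, so that there is exactly one). -/
def iterate (α : ℝ) (s : CoWSPMState K) : Fin K → ℝ :=
  Classical.epsilon fun x => x ∈ openSimplex K ∧ IsMinOn (objective α s) (openSimplex K) x

/-- The sampling distribution `p_t`. -/
def sampling (T : ℕ) (α : ℝ) (s : CoWSPMState K) (i : Fin K) : ℝ :=
  (1 - K / T) * iterate α s i + 1 / T

/-- The stability term `z_{t,i}` for the drawn arm `i = I_t` with observed loss `y` (it is zero for
all other arms). -/
def stability (T : ℕ) (α : ℝ) (s : CoWSPMState K) (i : Fin K) (y : ℝ) : ℝ :=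
  (y - prediction s i) ^ 2 *
    min ((6 * dParam) ^ (2 - α) / (2 * (1 - α)) *
          min (sampling T α s i ^ (-α)) ((1 - sampling T α s i) / sampling T α s i ^ 2))
      (s.rate i * (18 * dParam ^ 2) / barrier α)

/-- The penalty term `h_{t,i}`. -/
def penalty (T : ℕ) (α : ℝ) (s : CoWSPMState K) (i : Fin K) : ℝ :=
  1 / α * sampling T α s i ^ α

/-- The update of the state after arm `I` was drawn and its loss `y` observed. -/
def update (T : ℕ) (α : ℝ) (s : CoWSPMState K) (I : Fin K) (y : ℝ) : CoWSPMState K where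
  cumEst i := s.cumEst i +
    (prediction s i + if I = i then (y - prediction s i) / sampling T α s i else 0)
  rate i := s.rate i +
    (if I = i then stability T α s i y else 0) / (s.rate i * penalty T α s i)
  count i := s.count i + if I = i then 1 else 0
  lossSum i := s.lossSum i + if I = i then y else 0

/-- The state of the algorithm after a list of (drawn arm, observed loss) pairs. -/
def state (T : ℕ) (α : ℝ) (hist : List (Fin K × ℝ)) : CoWSPMState K :=
  hist.foldl (fun s x => update T α s x.1 x.2) (start K α)

end CoWSPM

/-- Coordinate-wise SPM with `K` arms, horizon `T` and parameter `α`, as a bandit policy. -/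
def coWSPM (K T : ℕ) (α : ℝ) : Policy K :=
  fun hist => CoWSPM.sampling T α (CoWSPM.state T α hist)

end Bandit

end

noncomputable section

namespace Bandit

section

/-! ### Scalar inequalities -/

/-! Regret is measured against the comparator `u = (1 - K/T) e_a + 1/T`, which together with the
uniform exploration in `p` costs `2 K` in total. The potential is the value of the unpredicted
regularized leader minus `⟨L, u⟩`. At the end it is at most the regularizer at `u`, of order `K log
T / (1 - α)`. At the start it is at least `-8 K ^ (2 - α) / (α (1 - α))`, the cost of the initial
rates. Since the loss estimates are unbiased, a round raises it in mean by at least `⟨ℓ, q - u⟩ - 8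
∑ p z / β`. Hence regret is bounded by these terms plus `8 E ∑ z / β` (`regret_le_sum_stability`).

The one-round estimate reduces to the drawn coordinate (`round_bound`). Half of the log-barrier pays
for the change of `β`. The other half, with the entropy, controls stability: the three entries in
the minimum defining `z` are what the Tsallis part, the partial Shannon part and the log-barrier can
each guarantee.

The rule `β' = β + z / (β h)` then makes `∑ z / β` telescope. With the potential `log β` one gets `z
/ β ≤ μ z h + O(1 / μ + 1) · Δ log β` for any `μ > 0`, which may differ between arms and is known
only to the analysis (`spm_log`). With a capped `β` as potential one gets a bound without `h`
(`spm_worst`).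

Adversarial regime: `z h` is at most a constant times `(ℓ - m) ^ 2`. Running averages predict as
well as any fixed vector up to `2 K log T` (`sum_sq_sub_prediction_le`). Comparing with a
near-minimizer of the variation, with `0` and with `1` yields `Q_∞`, `L* + R` and `T - L* - R`, and
the resulting inequality is solved for `R` (`self_bounding`). The worst-case bound uses `∑ p ^ (1 -
α) ≤ K ^ α` instead.

Stochastic regime: `μ` is taken proportional to the gap for suboptimal arms and to `1 / ∑ 1 / Δ` for
the optimal arm, whose term carries a factor `1 - p`. For every loss sequence the regret is then at
most the claimed bound plus `(1/2) ∑ Δ_i p_{t,i}` (`regret_le_gaps`). In expectation this last sum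
is the regret itself, because `p_t` depends only on earlier losses, so half of the regret is
absorbed (`stochastic_bound`). -/

theorem half_sub_one_le_sub_one_sub_log {r : ℝ} (hr : 4 ≤ r) :
    (r - 1) / 2 ≤ r - 1 - Real.log r := by
  have h1 : Real.log (r / 4) ≤ r / 4 - 1 := Real.log_le_sub_one_of_pos (by linarith)
  rw [Real.log_div (by linarith) (by norm_num)] at h1
  have h2 : Real.log 4 = 2 * Real.log 2 := by
    rw [show (4 : ℝ) = 2 ^ 2 by norm_num, Real.log_pow]; norm_num
  have := Real.log_two_lt_d9
  linarith

theorem sub_one_sub_log_nonneg {r : ℝ} (hr : 0 < r) : 0 ≤ r - 1 - Real.log r := by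
  linarith [Real.log_le_sub_one_of_pos hr]

theorem rpow_le_one_add_mul {α r : ℝ} (hα : 0 < α) (hα1 : α < 1) (hr : 0 < r) :
    r ^ α ≤ 1 + α * (r - 1) := by
  have := rpow_one_add_le_one_add_mul_self (s := r - 1) (by linarith) hα.le hα1.le
  simpa using this

/-- Bernoulli's inequality for `√r`, squared, gives `r ^ α ≤ (1 + α (√r - 1)) ^ 2`; inserting this
bound turns the right side into exactly `(1 - α) (√r - 1) ^ 2`. -/
theorem tsallis_gap {α r : ℝ} (hα : 0 < α) (hα1 : α < 1) (hr : 0 < r) :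
    (1 - α) * (√r - 1) ^ 2 ≤ (1 - r ^ α) / α + r - 1 := by
  have h0 := Real.sqrt_pos.2 hr
  have h := rpow_le_one_add_mul hα hα1 h0
  have hsq : r = √r * √r := (Real.mul_self_sqrt hr.le).symm
  have hp : r ^ α = √r ^ α * √r ^ α := by
    conv_lhs => rw [hsq]
    exact Real.mul_rpow h0.le h0.le
  have h3 : r ^ α ≤ (1 + α * (√r - 1)) ^ 2 := by
    rw [hp, ← sq]; exact pow_le_pow_left₀ (by positivity) h 2
  have h4 : (1 - α) * (√r - 1) ^ 2 - (r - 1) ≤ (1 - r ^ α) / α := by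
    rw [le_div_iff₀ hα]
    nlinarith
  linarith

theorem tsallis_gap_quadratic {α r : ℝ} (hα : 0 < α) (hα1 : α < 1) (hr : 0 < r) (hr4 : r ≤ 4) :
    (1 - α) * (r - 1) ^ 2 / 9 ≤ (1 - r ^ α) / α + r - 1 := by
  refine le_trans ?_ (tsallis_gap hα hα1 hr)
  have h0 := Real.sqrt_pos.2 hr
  have h2 : √r ≤ 2 := by
    rw [Real.sqrt_le_left (by norm_num)]; linarith
  have hsq : r - 1 = (√r - 1) * (√r + 1) := by nlinarith [Real.mul_self_sqrt hr.le]
  rw [hsq, mul_pow]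
  have : (√r + 1) ^ 2 ≤ 9 := by nlinarith
  have h5 : (√r - 1) ^ 2 * (√r + 1) ^ 2 ≤ (√r - 1) ^ 2 * 9 :=
    mul_le_mul_of_nonneg_left this (sq_nonneg _)
  have : (1 - α) * ((√r - 1) ^ 2 * (√r + 1) ^ 2) ≤ (1 - α) * ((√r - 1) ^ 2 * 9) :=
    mul_le_mul_of_nonneg_left h5 (by linarith)
  linarith

/-! ### Bregman divergences of the parts of the regularizer -/

/-- The function whose `β`-weighted sum is the entropy part of the regularizer. -/
def entropy (α x : ℝ) : ℝ := -(x ^ α) / α + (1 - x) * Real.log (1 - x) + x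

/-- The derivative of `entropy`. -/
def entropyDeriv (α x : ℝ) : ℝ := -x ^ (α - 1) - Real.log (1 - x)

/-- The Bregman divergence of `entropy`. -/
def entropyDiv (α x q : ℝ) : ℝ := entropy α x - entropy α q - entropyDeriv α q * (x - q)

/-- The Bregman divergence of `-log`. -/
def logDiv (x q : ℝ) : ℝ := x / q - 1 - Real.log (x / q)

theorem logDiv_nonneg {x q : ℝ} (hx : 0 < x) (hq : 0 < q) : 0 ≤ logDiv x q :=
  sub_one_sub_log_nonneg (div_pos hx hq)

/-- The Bregman divergence of `(1 - x) log (1 - x) + x`. -/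
def coDiv (x q : ℝ) : ℝ :=
  (1 - x) * Real.log (1 - x) - (1 - x) * Real.log (1 - q) - (1 - x) + (1 - q)

/-- The Tsallis part is homogeneous, so its divergence is `q ^ α` times a function of the ratio `x /
q` alone. That ratio is the variable in which the later cases are split. -/
theorem entropyDiv_eq {α x q : ℝ} (hx : 0 < x) (hq : 0 < q) :
    entropyDiv α x q = q ^ α * ((1 - (x / q) ^ α) / α + x / q - 1) + coDiv x q := by
  have h1 : (x / q) ^ α = x ^ α / q ^ α := Real.div_rpow hx.le hq.le α
  have h2 : q ^ (α - 1) = q ^ α / q := Real.rpow_sub_one hq.ne' α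
  have h3 : q ^ α ≠ 0 := (Real.rpow_pos_of_pos hq α).ne'
  unfold entropyDiv entropy entropyDeriv coDiv
  rw [h1, h2]
  have : q ^ α * ((1 - x ^ α / q ^ α) / α + x / q - 1)
      = (q ^ α - x ^ α) / α + q ^ α / q * x - q ^ α := by
    field_simp
  rw [this]
  have h5 : q ^ α / q * q = q ^ α := by field_simp
  rw [sub_div]
  linear_combination -h5

/-- Fenchel's inequality for the binary relative entropy part. -/
theorem coDiv_fenchel {x q ε : ℝ} (hx : x < 1) (hq : q < 1) (hε : |ε| ≤ 1) :
    -(1 - q) * ε ^ 2 ≤ coDiv x q + ε * (x - q) := by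
  have hx' : 0 < 1 - x := by linarith
  have hq' : 0 < 1 - q := by linarith
  -- The right side of the claim is minimal in `x` where `1 - x = (1 - q) exp ε`; this is the
  -- tangent bound for the logarithm at that point.
  have h1 : 1 - ((1 - x) / ((1 - q) * Real.exp ε))⁻¹ ≤
      Real.log ((1 - x) / ((1 - q) * Real.exp ε)) :=
    Real.one_sub_inv_le_log_of_pos (by positivity)
  rw [Real.log_div hx'.ne' (by positivity), Real.log_mul hq'.ne' (Real.exp_ne_zero _),
    Real.log_exp] at h1
  have h2 := mul_le_mul_of_nonneg_left h1 hx'.le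
  have h3 : (1 - x) * (1 - ((1 - x) / ((1 - q) * Real.exp ε))⁻¹)
      = (1 - x) - (1 - q) * Real.exp ε := by
    field_simp
  rw [h3] at h2
  have h4 : Real.exp ε - 1 - ε ≤ ε ^ 2 :=
    (le_abs_self _).trans (Real.abs_exp_sub_one_sub_id_le hε)
  have h5 := mul_le_mul_of_nonneg_left h4 hq'.le
  unfold coDiv
  linarith

theorem coDiv_nonneg {x q : ℝ} (hx : x < 1) (hq : q < 1) : 0 ≤ coDiv x q := by
  simpa using coDiv_fenchel (ε := 0) hx hq (by simp)

theorem entropyDiv_nonneg {α x q : ℝ} (hα : 0 < α) (hα1 : α < 1) (hx : 0 < x) (hx1 : x < 1)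
    (hq : 0 < q) (hq1 : q < 1) : 0 ≤ entropyDiv α x q := by
  rw [entropyDiv_eq hx hq]
  have := tsallis_gap hα hα1 (div_pos hx hq)
  have h2 : 0 ≤ (1 - α) * (√(x / q) - 1) ^ 2 := mul_nonneg (by linarith) (sq_nonneg _)
  exact add_nonneg (mul_nonneg (by positivity) (h2.trans this)) (coDiv_nonneg hx1 hq1)

theorem neg_rpow_div_le_entropy {α x : ℝ} (hx1 : x < 1) :
    -(x ^ α / α) ≤ entropy α x := by
  -- At `q = 0` the divergence is exactly the non-Tsallis part of `entropy`.
  have h := coDiv_nonneg (q := 0) hx1 (by norm_num)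
  unfold coDiv at h
  unfold entropy
  simp only [sub_zero, Real.log_one, mul_zero] at h
  rw [neg_div]
  linarith

theorem entropy_nonpos {α x : ℝ} (hα : 0 < α) (hα1 : α < 1) (hx : 0 < x) (hx1 : x < 1) :
    entropy α x ≤ 0 := by
  have h1 : Real.log (1 - x) ≤ -x := by
    have := Real.log_le_sub_one_of_pos (sub_pos.2 hx1); linarith
  have h2 := mul_le_mul_of_nonneg_left h1 (sub_nonneg.2 hx1.le)
  have h3 : x ≤ x ^ α := by
    simpa using Real.rpow_le_rpow_of_exponent_ge hx hx1.le hα1.le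
  have h4 : x ^ α ≤ x ^ α / α := by
    rw [le_div_iff₀ hα]
    have := Real.rpow_pos_of_pos hx α
    nlinarith
  unfold entropy
  rw [neg_div]
  nlinarith

/-! ### The log-barrier coefficient and the stability estimates -/

theorem six_le_barrier (α : ℝ) : 6 ≤ CoWSPM.barrier α := le_max_left _ _

/-- The constant is `384 = 4 · (4/3) · 72`, as needed for a quarter of the barrier to beat the
linear growth in `rate_change_bound`. -/
theorem barrier_sq {α : ℝ} (hα : 0 < α) (hα1 : α < 1) : 384 * α ≤ CoWSPM.barrier α ^ 2 := by
  have h1 : 48 * √(α / (1 - α)) ≤ CoWSPM.barrier α := le_max_right _ _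
  have h2 : (48 * √(α / (1 - α))) ^ 2 ≤ CoWSPM.barrier α ^ 2 :=
    pow_le_pow_left₀ (by positivity) h1 2
  have h3 : α ≤ α / (1 - α) := by
    rw [le_div_iff₀ (by linarith)]; nlinarith
  rw [mul_pow, Real.sq_sqrt (div_nonneg hα.le (by linarith))] at h2
  linarith

theorem barrier_le {α : ℝ} (hα : 0 < α) (hα1 : α < 1) :
    CoWSPM.barrier α ≤ 48 / (1 - α) := by
  have h : 0 < 1 - α := by linarith
  refine max_le ?_ ?_
  · rw [le_div_iff₀ h]; nlinarith
  · rw [← mul_one_div 48 (1 - α)]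
    refine mul_le_mul_of_nonneg_left ?_ (by norm_num)
    rw [Real.sqrt_le_left (by positivity), div_pow, one_pow]
    rw [div_le_div_iff₀ h (by positivity)]
    nlinarith

/-- Half of the log-barrier absorbs the change of the learning rate. -/
theorem rate_change_bound {α x q δ Z : ℝ} (hα : 0 < α) (hα1 : α < 1) (hx : 0 < x) (hx1 : x < 1)
    (hq : 0 < q) (hδ : 0 ≤ δ) (hδZ : δ * (q ^ α / α) ≤ 4 / 3 * Z)
    (hZ : Z ≤ 72 / CoWSPM.barrier α) (hZ0 : 0 ≤ Z) :
    -(6 * Z) ≤ CoWSPM.barrier α / 2 * logDiv x q + δ * entropy α x := by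
  set γ := CoWSPM.barrier α
  have hγ : 6 ≤ γ := six_le_barrier α
  have hr : 0 < x / q := div_pos hx hq
  have h1 : -(δ * (q ^ α / α) * (x / q) ^ α) ≤ δ * entropy α x := by
    have h := mul_le_mul_of_nonneg_left (neg_rpow_div_le_entropy (α := α) hx1) hδ
    have h2 : x ^ α = q ^ α * (x / q) ^ α := by
      rw [← Real.mul_rpow hq.le hr.le]; congr 1; field_simp
    rw [h2] at h
    calc _ = δ * -(q ^ α * (x / q) ^ α / α) := by ring
      _ ≤ _ := h
  have h2 : δ * (q ^ α / α) * (x / q) ^ α ≤ 4 / 3 * Z * (x / q) ^ α :=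
    mul_le_mul_of_nonneg_right hδZ (by positivity)
  have hD := logDiv_nonneg hx hq
  -- For `x ≤ 4 q` the entropy change costs at most `(16/3) Z`. Beyond that, Bernoulli makes the
  -- cost linear in `x / q`, and the logarithmic divergence grows at least linearly too.
  rcases le_total (x / q) 4 with h4 | h4
  · have h5 : (x / q) ^ α ≤ 4 := by
      calc (x / q) ^ α ≤ 4 ^ α := Real.rpow_le_rpow hr.le h4 hα.le
        _ ≤ 4 ^ (1 : ℝ) := Real.rpow_le_rpow_of_exponent_le (by norm_num) hα1.le
        _ = 4 := by norm_num
    have h6 : 4 / 3 * Z * (x / q) ^ α ≤ 4 / 3 * Z * 4 :=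
      mul_le_mul_of_nonneg_left h5 (by positivity)
    have h7 : 0 ≤ γ / 2 * logDiv x q := mul_nonneg (by linarith) hD
    linarith
  · have h5 := rpow_le_one_add_mul hα hα1 hr
    have h6 : 4 / 3 * Z * (x / q) ^ α ≤ 4 / 3 * Z * (1 + α * (x / q - 1)) :=
      mul_le_mul_of_nonneg_left h5 (by positivity)
    have h7 : (x / q - 1) / 2 ≤ logDiv x q := half_sub_one_le_sub_one_sub_log h4
    have h8 : 4 / 3 * Z * α ≤ γ / 4 := by
      have h9 : Z * γ ≤ 72 := by rwa [le_div_iff₀ (by linarith)] at hZ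
      have h10 := barrier_sq hα hα1
      have h11 : 4 / 3 * Z * α * γ ≤ γ / 4 * γ := by
        change 384 * α ≤ γ ^ 2 at h10
        nlinarith
      exact le_of_mul_le_mul_right h11 (by linarith)
    have h12 : 4 / 3 * Z * α * (x / q - 1) ≤ γ / 4 * (x / q - 1) :=
      mul_le_mul_of_nonneg_right h8 (by linarith)
    have h13 : γ / 2 * ((x / q - 1) / 2) ≤ γ / 2 * logDiv x q :=
      mul_le_mul_of_nonneg_left h7 (by linarith)
    linarith

/-- The log-barrier bounds the stability term by the inverse barrier coefficient. -/
theorem stability_log {x q b κ : ℝ} (hx : 0 < x) (hq : 0 < q) (hκ : 0 < κ)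
    (hb : |b| ≤ κ / 2) :
    -(2 * b ^ 2 / κ) ≤ κ * logDiv x q + b * (x / q - 1) := by
  obtain ⟨ε, rfl⟩ : ∃ ε, b = κ * ε := ⟨b / κ, by field_simp⟩
  rw [abs_mul, abs_of_pos hκ] at hb
  have hε : |ε| ≤ 1 / 2 := by
    by_contra hc
    push Not at hc
    nlinarith
  have hε' := abs_le.1 hε
  have hr : 0 < x / q := div_pos hx hq
  have h1 : 0 < 1 + ε := by linarith
  -- Tangent bound at `x / q = 1 / (1 + ε)`, where the right side of the claim is minimal.
  have h2 := Real.log_le_sub_one_of_pos (mul_pos hr h1)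
  rw [Real.log_mul hr.ne' h1.ne'] at h2
  have h3 := Real.one_sub_inv_le_log_of_pos h1
  have h4 : ε - 2 * ε ^ 2 ≤ 1 - (1 + ε)⁻¹ := by
    rw [← sub_nonneg]
    have : 1 - (1 + ε)⁻¹ - (ε - 2 * ε ^ 2) = ε ^ 2 * (1 + 2 * ε) / (1 + ε) := by
      field_simp; ring
    rw [this]
    exact div_nonneg (mul_nonneg (sq_nonneg _) (by linarith)) h1.le
  have h5 : -(2 * ε ^ 2) ≤ logDiv x q + ε * (x / q - 1) := by
    unfold logDiv; linarith
  have h6 := mul_le_mul_of_nonneg_left h5 hκ.le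
  have h7 : 2 * (κ * ε) ^ 2 / κ = κ * (2 * ε ^ 2) := by field_simp
  rw [h7]; linarith

/-- The Tsallis entropy bounds the stability term, the log-barrier keeping `x` of the order of
`q`. -/
theorem stability_tsallis {α β κ x q b : ℝ} (hα : 0 < α) (hα1 : α < 1) (hβ : 0 < β)
    (hκ : 3 ≤ κ) (hx : 0 < x) (hx1 : x < 1) (hq : 0 < q) (hq1 : q < 1) (hb : |b| ≤ 4 / 3) :
    -(9 * b ^ 2 / (4 * β * q ^ α * (1 - α))) ≤
      β * entropyDiv α x q + κ * logDiv x q + b * (x / q - 1) := by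
  have hr : 0 < x / q := div_pos hx hq
  have hα' : 0 < 1 - α := by linarith
  have hqα : 0 < q ^ α := Real.rpow_pos_of_pos hq α
  rcases le_total (x / q) 4 with h4 | h4
  · have h1 := tsallis_gap_quadratic hα hα1 hr h4
    have h2 := entropyDiv_eq (α := α) hx hq
    have h3 := coDiv_nonneg hx1 hq1
    have h4 := mul_nonneg (by linarith : 0 ≤ κ) (logDiv_nonneg hx hq)
    have h5 := mul_le_mul_of_nonneg_left h1 hqα.le
    have h6 : β * (q ^ α * ((1 - α) * (x / q - 1) ^ 2 / 9)) ≤ β * entropyDiv α x q :=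
      mul_le_mul_of_nonneg_left (by linarith) hβ.le
    set A := β * q ^ α * (1 - α) with hA
    have hA0 : 0 < A := by positivity
    have h7 : -(9 * b ^ 2 / (4 * A)) ≤ A * (x / q - 1) ^ 2 / 9 + b * (x / q - 1) := by
      rw [neg_le_iff_add_nonneg]
      have : A * (x / q - 1) ^ 2 / 9 + b * (x / q - 1) + 9 * b ^ 2 / (4 * A)
          = (2 * A * (x / q - 1) + 9 * b) ^ 2 / (36 * A) := by
        field_simp; ring
      rw [this]; positivity
    have h8 : 4 * β * q ^ α * (1 - α) = 4 * A := by rw [hA]; ring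
    rw [h8]
    have h9 : β * (q ^ α * ((1 - α) * (x / q - 1) ^ 2 / 9)) = A * (x / q - 1) ^ 2 / 9 := by
      rw [hA]; ring
    linarith
  -- Far from `q` the barrier suffices: its slope `κ / 2 ≥ 3/2` exceeds `|b| ≤ 4/3`.
  · have h1 := mul_nonneg hβ.le (entropyDiv_nonneg hα hα1 hx hx1 hq hq1)
    have h2 : (x / q - 1) / 2 ≤ logDiv x q := half_sub_one_le_sub_one_sub_log h4
    have h3 : -(4 / 3) ≤ b := (abs_le.1 hb).1
    have h4' : 0 ≤ 9 * b ^ 2 / (4 * β * q ^ α * (1 - α)) := by positivity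
    have h5 : κ * ((x / q - 1) / 2) ≤ κ * logDiv x q :=
      mul_le_mul_of_nonneg_left h2 (by linarith)
    nlinarith

/-- The partial Shannon entropy bounds the stability term of an arm of large probability. -/
theorem stability_shannon {α β κ x q g : ℝ} (hα : 0 < α) (hα1 : α < 1) (hβ : 0 < β)
    (hκ : 0 ≤ κ) (hx : 0 < x) (hx1 : x < 1) (hq : 0 < q) (hq1 : q < 1) (hg : |g| ≤ β) :
    -((1 - q) * g ^ 2 / β) ≤ β * entropyDiv α x q + κ * logDiv x q + g * (x - q) := by
  have h1 := mul_nonneg hκ (logDiv_nonneg hx hq)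
  have hε : |g / β| ≤ 1 := by
    rw [abs_div, abs_of_pos hβ]; exact div_le_one_of_le₀ hg hβ.le
  have h2 := mul_le_mul_of_nonneg_left (coDiv_fenchel hx1 hq1 hε) hβ.le
  have h3 : coDiv x q ≤ entropyDiv α x q := by
    rw [entropyDiv_eq hx hq]
    have := tsallis_gap hα hα1 (div_pos hx hq)
    have h2 : 0 ≤ (1 - α) * (√(x / q) - 1) ^ 2 := mul_nonneg (by linarith) (sq_nonneg _)
    have := mul_nonneg (Real.rpow_pos_of_pos hq α).le (h2.trans this)
    linarith
  have h4 := mul_le_mul_of_nonneg_left h3 hβ.le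
  have h5 : β * (-(1 - q) * (g / β) ^ 2) = -((1 - q) * g ^ 2 / β) := by field_simp
  have h6 : β * (coDiv x q + g / β * (x - q)) = β * coDiv x q + g * (x - q) := by field_simp
  linarith

/-- The stability term of one round, in terms of the loss deviation `w`, the probabilities `p`
and the learning rate. -/
def stab (α β p w : ℝ) : ℝ :=
  w ^ 2 * min ((6 * CoWSPM.dParam) ^ (2 - α) / (2 * (1 - α)) *
    min (p ^ (-α)) ((1 - p) / p ^ 2)) (β * (18 * CoWSPM.dParam ^ 2) / CoWSPM.barrier α)

theorem dParam_coeff_bounds {α : ℝ} (hα : 0 < α) (hα1 : α < 1) :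
    6 / (1 - α) ≤ (6 * CoWSPM.dParam) ^ (2 - α) / (2 * (1 - α)) ∧
      (6 * CoWSPM.dParam) ^ (2 - α) / (2 * (1 - α)) ≤ 72 / (1 - α) := by
  have h : 0 < 1 - α := by linarith
  have h0 : 6 * CoWSPM.dParam = 12 := by unfold CoWSPM.dParam; norm_num
  have h1 : (12 : ℝ) ≤ 12 ^ (2 - α) := by
    simpa using Real.rpow_le_rpow_of_exponent_le (x := 12) (by norm_num)
      (by linarith : (1 : ℝ) ≤ 2 - α)
  have h2 : (12 : ℝ) ^ (2 - α) ≤ 144 := by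
    have := Real.rpow_le_rpow_of_exponent_le (x := 12) (by norm_num)
      (by linarith : 2 - α ≤ (2 : ℝ))
    norm_num at this ⊢; exact this
  rw [h0]
  constructor
  · rw [div_le_div_iff₀ h (by linarith)]; nlinarith
  · rw [div_le_div_iff₀ (by linarith) h]; nlinarith

/-- Each entry of the minimum in `stab` is proved by its own part of the regularizer:
`stability_tsallis` for `p ^ (-α)`, `stability_shannon` for `(1 - p) / p ^ 2` and `stability_log`
for the last. It suffices to treat the entry that attains the minimum. -/
theorem stability_bound {α β x q p w : ℝ} (hα : 0 < α) (hα1 : α < 1) (hβ : 2 ≤ β)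
    (hx : 0 < x) (hx1 : x < 1) (hq : 0 < q) (hq1 : q < 1) (hp : 0 < p) (hp1 : p < 1)
    (hpq : 3 / 4 * q ≤ p) (hpq1 : 3 / 4 * (1 - q) ≤ 1 - p) (hw : |w| ≤ 1) :
    -(2 * (stab α β p w / β)) ≤ β * entropyDiv α x q + CoWSPM.barrier α / 2 * logDiv x q
      + w / p * (x - q) := by
  have hγ := six_le_barrier α
  set γ := CoWSPM.barrier α
  have hα' : 0 < 1 - α := by linarith
  have hβ0 : 0 < β := by linarith
  have hD := mul_nonneg hβ0.le (entropyDiv_nonneg hα hα1 hx hx1 hq hq1)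
  have hqp : q / p ≤ 4 / 3 := by rw [div_le_div_iff₀ hp (by norm_num)]; linarith
  have hqp0 : 0 < q / p := div_pos hq hp
  have hlin : w / p * (x - q) = w * (q / p) * (x / q - 1) := by field_simp
  have hb : |w * (q / p)| ≤ 4 / 3 := by
    rw [abs_mul, abs_of_pos hqp0]; nlinarith [abs_nonneg w]
  have hb2 : (w * (q / p)) ^ 2 ≤ 16 / 9 * w ^ 2 := by
    rw [mul_pow]
    have : (q / p) ^ 2 ≤ 16 / 9 := by nlinarith
    nlinarith [sq_nonneg w]
  obtain ⟨hc, -⟩ := dParam_coeff_bounds hα hα1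
  set c := (6 * CoWSPM.dParam) ^ (2 - α) / (2 * (1 - α)) with hcdef
  -- the bound in terms of `p ^ (-α)`
  have hts : -(4 * (w ^ 2 * p ^ (-α)) / ((1 - α) * β)) ≤
      β * entropyDiv α x q + γ / 2 * logDiv x q + w / p * (x - q) := by
    have h := stability_tsallis hα hα1 hβ0 (by linarith : 3 ≤ γ / 2) hx hx1 hq hq1 hb
    rw [← hlin] at h
    refine le_trans (neg_le_neg ?_) h
    have hqα : 0 < q ^ α := Real.rpow_pos_of_pos hq α
    have h1 : (w * (q / p)) ^ 2 / q ^ α = w ^ 2 * p ^ (-α) * (q / p) ^ (2 - α) := by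
      rw [Real.rpow_sub hqp0, Real.div_rpow hq.le hp.le α, Real.rpow_neg hp.le, Real.rpow_two]
      field_simp
    have h2 : (q / p) ^ (2 - α) ≤ 16 / 9 := by
      calc (q / p) ^ (2 - α) ≤ (4 / 3) ^ (2 - α) :=
            Real.rpow_le_rpow hqp0.le hqp (by linarith)
        _ ≤ (4 / 3) ^ (2 : ℝ) := Real.rpow_le_rpow_of_exponent_le (by norm_num) (by linarith)
        _ = 16 / 9 := by norm_num
    calc 9 * (w * (q / p)) ^ 2 / (4 * β * q ^ α * (1 - α))
        = 9 / 4 * ((w * (q / p)) ^ 2 / q ^ α) / ((1 - α) * β) := by field_simp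
      _ ≤ 9 / 4 * (w ^ 2 * p ^ (-α) * (16 / 9)) / ((1 - α) * β) := by
          rw [h1]; gcongr
      _ = _ := by ring
  have hfin : ∀ X Y : ℝ, X ≤ 2 * c * Y → 0 ≤ Y →
      -(X * w ^ 2 / β) ≤ β * entropyDiv α x q + γ / 2 * logDiv x q + w / p * (x - q) →
      -(2 * (w ^ 2 * (c * Y) / β)) ≤
        β * entropyDiv α x q + γ / 2 * logDiv x q + w / p * (x - q) := by
    intro X Y h1 h2 h3
    refine le_trans (neg_le_neg ?_) h3
    rw [← mul_div_assoc]
    have h4 := mul_le_mul_of_nonneg_right h1 (sq_nonneg w)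
    exact div_le_div_of_nonneg_right (by linarith) hβ0.le
  unfold stab
  rw [← hcdef]
  rcases min_choice (c * min (p ^ (-α)) ((1 - p) / p ^ 2))
    (β * (18 * CoWSPM.dParam ^ 2) / CoWSPM.barrier α) with h | h
  · rw [h]
    rcases min_choice (p ^ (-α)) ((1 - p) / p ^ 2) with h' | h'
    · rw [h']
      refine hfin (4 * p ^ (-α) / (1 - α)) _ ?_ (by positivity) ?_
      · have : 4 / (1 - α) ≤ 2 * c := by
          refine le_trans ?_ (le_trans hc ?_)
          · gcongr; norm_num
          · have : 0 ≤ c := le_trans (by positivity) hc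
            linarith
        calc _ = 4 / (1 - α) * p ^ (-α) := by ring
          _ ≤ _ := mul_le_mul_of_nonneg_right this (by positivity)
      · refine le_trans (le_of_eq ?_) hts
        field_simp
    · rw [h']
      have hY : 0 ≤ (1 - p) / p ^ 2 := div_nonneg (by linarith) (by positivity)
      -- The Shannon bound needs `|w / p| ≤ β`, which `2 ≤ β` gives for `p ≥ 1/2`. For smaller `p`
      -- the Tsallis bound is good enough, since `p ^ (-α) ≤ p ^ (-2) ≤ 2 (1 - p) / p ^ 2`.
      rcases le_total p (1 / 2) with hp2 | hp2
      · refine hfin (4 * p ^ (-α) / (1 - α)) _ ?_ hY ?_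
        · have h2 : p ^ (-α) ≤ 2 * ((1 - p) / p ^ 2) := by
            calc p ^ (-α) ≤ p ^ (-2 : ℝ) :=
                  Real.rpow_le_rpow_of_exponent_ge hp hp1.le (by linarith)
              _ = 1 / p ^ 2 := by
                  rw [Real.rpow_neg hp.le]; norm_num
              _ ≤ _ := by
                  rw [← mul_div_assoc]; gcongr; linarith
          calc _ = 4 / (1 - α) * p ^ (-α) := by ring
            _ ≤ 4 / (1 - α) * (2 * ((1 - p) / p ^ 2)) := by gcongr
            _ = 8 / 6 * (6 / (1 - α)) * ((1 - p) / p ^ 2) := by ring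
            _ ≤ 8 / 6 * c * ((1 - p) / p ^ 2) := by gcongr
            _ ≤ _ := by
                have : 0 ≤ c := le_trans (by positivity) hc
                gcongr; norm_num
        · refine le_trans (le_of_eq ?_) hts
          field_simp
      · refine hfin ((1 - q) / p ^ 2) _ ?_ hY ?_
        · have h1 : (1 - q) / p ^ 2 ≤ 4 / 3 * ((1 - p) / p ^ 2) := by
            rw [← mul_div_assoc]; gcongr; linarith
          have h2 : 6 ≤ c := by
            refine le_trans ?_ hc
            rw [le_div_iff₀ hα']; linarith
          nlinarith
        · have hg : |w / p| ≤ β := by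
            rw [abs_div, abs_of_pos hp, div_le_iff₀ hp]
            nlinarith
          refine le_trans (le_of_eq ?_) (stability_shannon hα hα1 hβ0 (by linarith) hx hx1 hq hq1 hg)
          field_simp
  · rw [h]
    have h1 := stability_log (κ := γ / 2) hx hq (by linarith) (b := w * (q / p))
      (by linarith)
    rw [← hlin] at h1
    have h2 : 2 * (w ^ 2 * (β * (18 * CoWSPM.dParam ^ 2) / γ) / β) = 144 * w ^ 2 / γ := by
      unfold CoWSPM.dParam; field_simp; ring
    have h3 : 2 * (w * (q / p)) ^ 2 / (γ / 2) ≤ 144 * w ^ 2 / γ := by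
      rw [div_le_div_iff₀ (by linarith) (by linarith)]
      nlinarith [sq_nonneg w]
    rw [h2]
    linarith

theorem stab_nonneg {α β p w : ℝ} (hα : 0 < α) (hα1 : α < 1) (hβ : 0 ≤ β) (hp : 0 < p)
    (hp1 : p ≤ 1) : 0 ≤ stab α β p w := by
  have hγ := six_le_barrier α
  have h := (dParam_coeff_bounds hα hα1).1
  have hα' : 0 < 1 - α := by linarith
  have h6 : 0 ≤ 6 / (1 - α) := by positivity
  refine mul_nonneg (sq_nonneg _) (le_min (mul_nonneg (h6.trans h) (le_min (by positivity)
    (div_nonneg (by linarith) (by positivity)))) (div_nonneg (by positivity) (by linarith)))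

/-- The third entry of the minimum is there for this cap: `rate_change_bound` requires it, and with
`6 ≤ γ` it gives `z / β ≤ 12`. -/
theorem stab_div_le {α β p w : ℝ} (hβ : 0 < β) (hw : |w| ≤ 1) :
    stab α β p w / β ≤ 72 / CoWSPM.barrier α := by
  have hγ := six_le_barrier α
  rw [div_le_iff₀ hβ]
  have h1 : w ^ 2 ≤ 1 := by rw [← sq_abs]; exact pow_le_one₀ (abs_nonneg _) hw
  have h0 : 0 ≤ β * (18 * CoWSPM.dParam ^ 2) / CoWSPM.barrier α :=
    div_nonneg (by positivity) (by linarith)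
  calc stab α β p w ≤ w ^ 2 * (β * (18 * CoWSPM.dParam ^ 2) / CoWSPM.barrier α) :=
        mul_le_mul_of_nonneg_left (min_le_right _ _) (sq_nonneg _)
    _ ≤ 1 * (β * (18 * CoWSPM.dParam ^ 2) / CoWSPM.barrier α) := by gcongr
    _ = _ := by unfold CoWSPM.dParam; ring

/-- The one-dimensional core of the analysis of a round of follow-the-regularized-leader. -/
theorem round_bound {α β x q p w : ℝ} (hα : 0 < α) (hα1 : α < 1) (hβ : 2 ≤ β)
    (hx : 0 < x) (hx1 : x < 1) (hq : 0 < q) (hq1 : q < 1) (hp : 0 < p) (hp1 : p < 1)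
    (hpq : 3 / 4 * q ≤ p) (hpq1 : 3 / 4 * (1 - q) ≤ 1 - p) (hw : |w| ≤ 1) :
    -(8 * (stab α β p w / β)) ≤ β * entropyDiv α x q + CoWSPM.barrier α * logDiv x q
      + w / p * (x - q) + stab α β p w / (β * (1 / α * p ^ α)) * entropy α x := by
  have hβ0 : 0 < β := by linarith
  have hs := stab_nonneg (w := w) hα hα1 hβ0.le hp hp1.le
  -- Half of the barrier goes into this bound and half into the rate change below; the losses `2 z /
  -- β` and `6 z / β` add up to `8 z / β`.
  have h1 := stability_bound hα hα1 hβ hx hx1 hq hq1 hp hp1 hpq hpq1 hw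
  have hpα : 0 < p ^ α := Real.rpow_pos_of_pos hp α
  have h2 := rate_change_bound (x := x) (q := q) (δ := stab α β p w / (β * (1 / α * p ^ α)))
    (Z := stab α β p w / β) hα hα1 hx hx1 hq (by positivity) ?_
    (stab_div_le hβ0 hw) (by positivity)
  · linarith
  · have h3 : q ^ α ≤ 4 / 3 * p ^ α := by
      calc q ^ α ≤ (4 / 3 * p) ^ α := Real.rpow_le_rpow hq.le (by linarith) hα.le
        _ = (4 / 3) ^ α * p ^ α := Real.mul_rpow (by norm_num) hp.le
        _ ≤ (4 / 3) ^ (1 : ℝ) * p ^ α := by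
            gcongr
            · norm_num
        _ = _ := by norm_num
    calc stab α β p w / (β * (1 / α * p ^ α)) * (q ^ α / α)
        = stab α β p w / β * (q ^ α / p ^ α) := by field_simp
      _ ≤ stab α β p w / β * (4 / 3) := by
          refine mul_le_mul_of_nonneg_left ?_ (by positivity)
          rwa [div_le_iff₀ hpα]
      _ = _ := by ring

/-! ### Scalar stability-penalty matching -/

theorem le_two_mul_log_one_add {x : ℝ} (hx : 0 ≤ x) (hx1 : x ≤ 1) :
    x ≤ 2 * Real.log (1 + x) := by
  have h := Real.one_sub_inv_le_log_of_pos (by linarith : 0 < 1 + x)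
  have h2 : x / 2 ≤ 1 - (1 + x)⁻¹ := by
    rw [← sub_nonneg]
    have : 1 - (1 + x)⁻¹ - x / 2 = x * (1 - x) / (2 * (1 + x)) := by field_simp; ring
    rw [this]
    exact div_nonneg (mul_nonneg hx (by linarith)) (by linarith)
  linarith

/-- Logarithmic form of stability-penalty matching: `β` is the learning rate, `z` the stability
term and `h` the penalty term of a round. -/
theorem spm_log {β z h μ : ℝ} (hβ : 0 < β) (hz : 0 ≤ z) (hh : 0 < h) (hμ : 0 < μ)
    (hz12 : z / β ≤ 12) :
    z / β ≤ μ * (z * h) + (1 / (2 * μ) + 24) * (Real.log (β + z / (β * h)) - Real.log β) := by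
  have hδ : 0 ≤ z / (β * h) := by positivity
  have hlog : Real.log (β + z / (β * h)) - Real.log β = Real.log (1 + z / (β * h) / β) := by
    rw [← Real.log_div (by positivity) hβ.ne']
    congr 1; field_simp
  rw [hlog]
  set x := z / (β * h) / β with hx
  have hx0 : 0 ≤ x := by positivity
  have hz' : z = x * β ^ 2 * h := by rw [hx]; field_simp
  have hl0 : 0 ≤ Real.log (1 + x) := Real.log_nonneg (by linarith)
  -- Here `x` is the relative increase of the rate. If the rate at most doubles, AM-GM on `β h` and
  -- `x ≤ 2 log (1 + x)` suffice. If it more than doubles, `log β` gains at least `log 2`, and `24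
  -- log 2` already exceeds `12`.
  rcases le_total x 1 with h1 | h1
  · have h2 := le_two_mul_log_one_add hx0 h1
    have h3 : z / β = x * (β * h) := by rw [hz']; field_simp
    have h4 : z * h = x * (β * h) ^ 2 := by rw [hz']; ring
    rw [h3, h4]
    have h5 : β * h ≤ μ * (β * h) ^ 2 + 1 / (4 * μ) := by
      rw [← sub_nonneg]
      have : μ * (β * h) ^ 2 + 1 / (4 * μ) - β * h = (2 * μ * (β * h) - 1) ^ 2 / (4 * μ) := by
        field_simp; ring
      rw [this]; positivity
    have h6 := mul_le_mul_of_nonneg_left h5 hx0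
    have h7 : x * (1 / (4 * μ)) ≤ 2 * Real.log (1 + x) * (1 / (4 * μ)) :=
      mul_le_mul_of_nonneg_right h2 (by positivity)
    have h8 : 2 * Real.log (1 + x) * (1 / (4 * μ)) = 1 / (2 * μ) * Real.log (1 + x) := by
      field_simp; ring
    linarith
  · have h2 : Real.log 2 ≤ Real.log (1 + x) := Real.log_le_log (by norm_num) (by linarith)
    have := Real.log_two_gt_d9
    have h3 : 0 ≤ μ * (z * h) := by positivity
    have h4 : 0 ≤ 1 / (2 * μ) * Real.log (1 + x) := by positivity
    linarith

/-- Worst-case form of stability-penalty matching for bounded penalties. -/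
theorem spm_worst {α β z h μ : ℝ} (hα : 0 < α) (hβ : 0 < β) (hz : 0 ≤ z) (hh : 0 < h)
    (hhα : h ≤ 1 / α) (hμ : 0 < μ) (hz12 : z / β ≤ 12) :
    z / β ≤ μ * z + (1 / α * (min (β + z / (β * h)) (2 / μ) - min β (2 / μ))
      + 24 * (Real.log (β + z / (β * h)) - Real.log β)) := by
  have hδ : 0 ≤ z / (β * h) := by positivity
  have hm : 0 ≤ min (β + z / (β * h)) (2 / μ) - min β (2 / μ) :=
    sub_nonneg.2 (min_le_min_right _ (by linarith))
  have hm' : 0 ≤ 1 / α * (min (β + z / (β * h)) (2 / μ) - min β (2 / μ)) :=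
    mul_nonneg (by positivity) hm
  have hl : 0 ≤ Real.log (β + z / (β * h)) - Real.log β :=
    sub_nonneg.2 (Real.log_le_log hβ (by linarith))
  have hz0 : 0 ≤ μ * z := by positivity
  -- Doubling rounds are paid by the logarithm. Otherwise either `β ≥ 1 / μ` and `z / β ≤ μ z`, or
  -- both rates lie below the cap `2 / μ` and `z / β = h Δβ ≤ Δβ / α`.
  rcases le_total (z / (β * h)) β with h1 | h1
  · rcases le_total (1 / μ) β with h2 | h2
    · have : z / β ≤ μ * z := by
        rw [div_le_iff₀ hβ]
        rw [div_le_iff₀ hμ] at h2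
        nlinarith
      linarith
    · have h3 : 2 / μ = 2 * (1 / μ) := by ring
      rw [min_eq_left (by linarith), min_eq_left (by linarith)] at *
      have h4 : z / β = h * (z / (β * h)) := by field_simp
      have h5 : h * (z / (β * h)) ≤ 1 / α * (z / (β * h)) := by gcongr
      have h6 : 1 / α * (β + z / (β * h) - β) = 1 / α * (z / (β * h)) := by ring
      linarith
  · have h2 : Real.log (2 * β) ≤ Real.log (β + z / (β * h)) :=
      Real.log_le_log (by positivity) (by linarith)
    rw [Real.log_mul (by norm_num) hβ.ne'] at h2
    have := Real.log_two_gt_d9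
    linarith

end

section

/-! ### The regularized leader -/

open CoWSPM Filter Topology

variable {K : ℕ}

/-- The linear-plus-regularizer objective of follow-the-regularized-leader. -/
def ftrlObjective (α : ℝ) (c β x : Fin K → ℝ) : ℝ := ∑ i, c i * x i + regularizer α β x

/-- A coordinate of `ftrlObjective`. -/
def coordObjective (α c β x : ℝ) : ℝ := c * x + β * entropy α x - barrier α * Real.log x

theorem ftrlObjective_eq (α : ℝ) (c β x : Fin K → ℝ) :
    ftrlObjective α c β x = ∑ i, coordObjective α (c i) (β i) (x i) := by
  unfold ftrlObjective regularizer coordObjective entropy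
  rw [Finset.sum_sub_distrib, Finset.sum_add_distrib, Finset.mul_sum]
  ring

theorem lt_one_of_mem_openSimplex (hK : 2 ≤ K) {x : Fin K → ℝ} (hx : x ∈ openSimplex K)
    (i : Fin K) : x i < 1 := by
  obtain ⟨⟨-, hsum⟩, hpos⟩ := hx
  have : Nontrivial (Fin K) := Fin.nontrivial_iff_two_le.2 hK
  obtain ⟨j, hj⟩ := exists_ne i
  rw [← hsum]
  exact Finset.single_lt_sum hj (Finset.mem_univ i) (Finset.mem_univ j) (hpos j)
    fun k _ _ => (hpos k).le

theorem uniform_mem_openSimplex (hK : 0 < K) : (fun _ => 1 / (K : ℝ)) ∈ openSimplex K := by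
  have : (0 : ℝ) < K := by exact_mod_cast hK
  refine ⟨⟨fun i => by positivity, ?_⟩, fun i => by positivity⟩
  simp [this.ne']

theorem hasDerivAt_entropy {α q : ℝ} (hα : 0 < α) (hq : 0 < q) (hq1 : q < 1) :
    HasDerivAt (entropy α) (entropyDeriv α q) q := by
  have h1 : HasDerivAt (fun x : ℝ => -(x ^ α) / α) (-(α * q ^ (α - 1)) / α) q :=
    ((Real.hasDerivAt_rpow_const (Or.inl hq.ne')).fun_neg).div_const α
  have h2 : HasDerivAt (fun x : ℝ => 1 - x) (-1) q := by
    simpa using (hasDerivAt_id q).const_sub 1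
  have h3 : HasDerivAt (fun x : ℝ => (1 - x) * Real.log (1 - x))
      (-1 * Real.log (1 - q) + (1 - q) * (-1 / (1 - q))) q :=
    h2.mul (h2.log (by linarith))
  have h4 := (h1.add h3).add (hasDerivAt_id q)
  refine h4.congr_deriv ?_
  have : 1 - q ≠ 0 := by linarith
  unfold entropyDeriv
  field_simp
  ring

theorem hasDerivAt_coordObjective {α c β q : ℝ} (hα : 0 < α) (hq : 0 < q) (hq1 : q < 1) :
    HasDerivAt (coordObjective α c β) (c + β * entropyDeriv α q - barrier α * q⁻¹) q := by
  have h1 : HasDerivAt (fun x : ℝ => c * x) c q := by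
    simpa using (hasDerivAt_id q).const_mul c
  exact (h1.add ((hasDerivAt_entropy hα hq hq1).const_mul β)).sub
    ((Real.hasDerivAt_log hq.ne').const_mul _)

/-- An exact first-order expansion: the linear term cancels out of every divergence, so only the
entropy and the barrier leave a remainder. -/
theorem coordObjective_sub {α c β x q : ℝ} (hx : 0 < x) (hq : 0 < q) :
    coordObjective α c β x = coordObjective α c β q
      + (c + β * entropyDeriv α q - barrier α * q⁻¹) * (x - q)
      + (β * entropyDiv α x q + barrier α * logDiv x q) := by
  unfold coordObjective entropyDiv logDiv
  rw [Real.log_div hx.ne' hq.ne', mul_sub _ x q]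
  have : q⁻¹ * q = 1 := inv_mul_cancel₀ hq.ne'
  have h2 : x / q = q⁻¹ * x := by rw [div_eq_inv_mul]
  rw [h2]
  linear_combination -barrier α * this

theorem segment_mem_openSimplex {x q : Fin K → ℝ} (hx : x ∈ openSimplex K)
    (hq : q ∈ openSimplex K) {s : ℝ} (hs : 0 ≤ s) (hs1 : s ≤ 1) :
    (fun i => q i + s * (x i - q i)) ∈ openSimplex K := by
  have hpos : ∀ i, 0 < q i + s * (x i - q i) := fun i => by
    have h1 := hx.2 i
    have h2 := hq.2 i
    rcases hs.eq_or_lt with rfl | h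
    · linarith
    · nlinarith [mul_pos h h1, mul_nonneg (sub_nonneg.2 hs1) h2.le]
  refine ⟨⟨fun i => (hpos i).le, ?_⟩, hpos⟩
  rw [Finset.sum_add_distrib, ← Finset.mul_sum, Finset.sum_sub_distrib, hx.1.2, hq.1.2]
  ring

/-- First-order optimality of the regularized leader, with the Bregman divergence as the gap. -/
theorem IsMinOn.bregman_le {α : ℝ} {c β x q : Fin K → ℝ} (hK : 2 ≤ K) (hα : 0 < α)
    (hq : q ∈ openSimplex K) (hmin : IsMinOn (ftrlObjective α c β) (openSimplex K) q)
    (hx : x ∈ openSimplex K) :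
    ftrlObjective α c β q
        + ∑ i, (β i * entropyDiv α (x i) (q i) + barrier α * logDiv (x i) (q i))
      ≤ ftrlObjective α c β x := by
  set g : Fin K → ℝ := fun i =>
    c i + β i * entropyDeriv α (q i) - barrier α * (q i)⁻¹ with hg
  have hderiv : HasDerivAt
      (fun s : ℝ => ∑ i, coordObjective α (c i) (β i) (q i + s * (x i - q i)))
      (∑ i, g i * (x i - q i)) 0 := by
    refine HasDerivAt.fun_sum fun i _ => ?_
    have h1 : HasDerivAt (fun s : ℝ => q i + s * (x i - q i)) (x i - q i) 0 := by
      simpa using ((hasDerivAt_id (0 : ℝ)).mul_const (x i - q i)).const_add (q i)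
    have h2 : HasDerivAt (coordObjective α (c i) (β i)) (g i) (q i + 0 * (x i - q i)) := by
      simpa using hasDerivAt_coordObjective (c := c i) (β := β i) hα (hq.2 i)
        (lt_one_of_mem_openSimplex hK hq i)
    exact h2.comp (0 : ℝ) h1
  have hfirst : 0 ≤ ∑ i, g i * (x i - q i) := by
    refine ge_of_tendsto (hderiv.tendsto_slope.mono_left
      (nhdsWithin_mono (0 : ℝ) (show Set.Ioi (0 : ℝ) ⊆ {0}ᶜ from fun s hs => hs.ne'))) ?_
    filter_upwards [Ioo_mem_nhdsGT (zero_lt_one (α := ℝ))] with s hs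
    rw [slope_def_field]
    refine div_nonneg (sub_nonneg.2 ?_) (by linarith [hs.1])
    have h := hmin (segment_mem_openSimplex hx hq hs.1.le hs.2.le)
    simp only [Set.mem_ofPred_eq, ftrlObjective_eq] at h
    simpa using h
  rw [ftrlObjective_eq, ftrlObjective_eq]
  have : ∑ i, coordObjective α (c i) (β i) (x i) = ∑ i, coordObjective α (c i) (β i) (q i)
      + ∑ i, g i * (x i - q i)
      + ∑ i, (β i * entropyDiv α (x i) (q i) + barrier α * logDiv (x i) (q i)) := by
    rw [← Finset.sum_add_distrib, ← Finset.sum_add_distrib]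
    exact Finset.sum_congr rfl fun i _ => coordObjective_sub (hx.2 i) (hq.2 i)
  linarith

theorem continuousOn_ftrlObjective {α : ℝ} (hα : 0 < α) (c β : Fin K → ℝ) :
    ContinuousOn (ftrlObjective α c β) {x | ∀ i, 0 < x i} := by
  have h : ftrlObjective α c β = fun x => ∑ i, coordObjective α (c i) (β i) (x i) := by
    ext x; exact ftrlObjective_eq α c β x
  rw [h]
  refine continuousOn_finsetSum _ fun i _ => ?_
  unfold coordObjective entropy
  have h1 : Continuous fun x : Fin K → ℝ => (1 - x i) * Real.log (1 - x i) :=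
    Real.continuous_mul_log.comp (f := fun x : Fin K → ℝ => 1 - x i) (by fun_prop)
  have h2 : ContinuousOn (fun x : Fin K → ℝ => Real.log (x i)) {x | ∀ i, 0 < x i} :=
    ContinuousOn.log (by fun_prop) fun x hx => (hx i).ne'
  have h3 : Continuous fun x : Fin K → ℝ => x i ^ α :=
    (continuous_apply i).rpow_const fun _ => Or.inr hα.le
  have h4 : Continuous fun x : Fin K → ℝ =>
      c i * x i + β i * (-(x i ^ α) / α + (1 - x i) * Real.log (1 - x i) + x i) := by
    fun_prop
  exact h4.continuousOn.sub (h2.const_smul (barrier α))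

/-- The regularized leader exists. -/
theorem exists_isMinOn_ftrlObjective {α : ℝ} (hK : 2 ≤ K) (hα : 0 < α) (c : Fin K → ℝ)
    {β : Fin K → ℝ} (hβ : ∀ i, 0 ≤ β i) :
    ∃ x ∈ openSimplex K, IsMinOn (ftrlObjective α c β) (openSimplex K) x := by
  have hγ := six_le_barrier α
  set x₀ : Fin K → ℝ := fun _ => 1 / (K : ℝ) with hx₀
  have hx₀m : x₀ ∈ openSimplex K := uniform_mem_openSimplex (by omega)
  -- The linear and entropy parts are at least `-B`. A coordinate below `exp (-M)` therefore pushes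
  -- the objective above its value at the uniform point, and minimizing over a compact set is
  -- enough; the term `1 / K` in `ε` keeps the uniform point in that set.
  set B : ℝ := ∑ i, (|c i| + β i / α) with hB
  set M : ℝ := max 0 (ftrlObjective α c β x₀ + B) with hM
  set ε : ℝ := min (1 / K) (Real.exp (-M)) with hε
  have hKpos : (0 : ℝ) < K := by exact_mod_cast (by omega : 0 < K)
  have hε0 : 0 < ε := lt_min (by positivity) (Real.exp_pos _)
  set S : Set (Fin K → ℝ) := stdSimplex ℝ (Fin K) ∩ {x | ∀ i, ε ≤ x i} with hS
  have hScomp : IsCompact S := by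
    refine (isCompact_stdSimplex ℝ (Fin K)).inter_right ?_
    rw [Set.ofPred_forall]
    exact isClosed_iInter fun i => isClosed_le continuous_const (continuous_apply i)
  have hSsub : S ⊆ openSimplex K := fun x hx => ⟨hx.1, fun i => hε0.trans_le (hx.2 i)⟩
  have hx₀S : x₀ ∈ S := ⟨hx₀m.1, fun i => min_le_left _ _⟩
  obtain ⟨q, hqS, hqmin⟩ := hScomp.exists_isMinOn ⟨x₀, hx₀S⟩
    ((continuousOn_ftrlObjective hα c β).mono fun x hx => (hSsub hx).2)
  refine ⟨q, hSsub hqS, fun x hx => ?_⟩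
  by_cases hxS : x ∈ S
  · exact hqmin hxS
  have h0 : ftrlObjective α c β q ≤ ftrlObjective α c β x₀ := hqmin hx₀S
  refine h0.trans ?_
  obtain ⟨j, hj⟩ : ∃ j, x j < ε := by
    by_contra hc
    push Not at hc
    exact hxS ⟨hx.1, hc⟩
  rw [ftrlObjective_eq α c β x]
  have hcoord : ∀ i, -(|c i| + β i / α) + (-Real.log (x i)) * 6
      ≤ coordObjective α (c i) (β i) (x i) := fun i => by
    have h1 := hx.2 i
    have h2 := lt_one_of_mem_openSimplex hK hx i
    have h3 : -|c i| ≤ c i * x i := by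
      have : |c i * x i| ≤ |c i| := by
        rw [abs_mul, abs_of_pos h1]
        exact mul_le_of_le_one_right (abs_nonneg _) h2.le
      linarith [neg_abs_le (c i * x i)]
    have h4 : -(1 / α) ≤ entropy α (x i) := by
      refine le_trans (neg_le_neg ?_) (neg_rpow_div_le_entropy h2)
      gcongr
      exact Real.rpow_le_one h1.le h2.le hα.le
    have h5 := mul_le_mul_of_nonneg_left h4 (hβ i)
    have h6 := Real.log_nonpos h1.le h2.le
    have h7 : -Real.log (x i) * 6 ≤ -Real.log (x i) * barrier α :=
      mul_le_mul_of_nonneg_left hγ (by linarith)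
    unfold coordObjective
    have h8 : β i * -(1 / α) = -(β i / α) := by ring
    linarith
  have hsum := Finset.sum_le_sum fun i (_ : i ∈ Finset.univ) => hcoord i
  rw [Finset.sum_add_distrib, Finset.sum_neg_distrib, ← hB] at hsum
  have hj2 : M ≤ -Real.log (x j) := by
    have h1 : Real.log (x j) ≤ Real.log (Real.exp (-M)) :=
      Real.log_le_log (hx.2 j) (hj.le.trans (min_le_right _ _))
    rw [Real.log_exp] at h1
    linarith
  have hsingle : -Real.log (x j) * 6 ≤ ∑ i, -Real.log (x i) * 6 :=
    Finset.single_le_sum (f := fun i => -Real.log (x i) * 6) (fun i _ => by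
      have := Real.log_nonpos (hx.2 i).le (lt_one_of_mem_openSimplex hK hx i).le
      linarith) (Finset.mem_univ j)
  have hM0 : 0 ≤ M := le_max_left _ _
  have hM1 : ftrlObjective α c β x₀ + B ≤ M := le_max_right _ _
  linarith

/-- The regularized leader. -/
def leader (α : ℝ) (c β : Fin K → ℝ) : Fin K → ℝ :=
  Classical.epsilon fun x => x ∈ openSimplex K ∧ IsMinOn (ftrlObjective α c β) (openSimplex K) x

theorem leader_spec {α : ℝ} (hK : 2 ≤ K) (hα : 0 < α) (c : Fin K → ℝ)
    {β : Fin K → ℝ} (hβ : ∀ i, 0 ≤ β i) :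
    leader α c β ∈ openSimplex K ∧
      IsMinOn (ftrlObjective α c β) (openSimplex K) (leader α c β) :=
  Classical.epsilon_spec (p := fun x => x ∈ openSimplex K ∧
    IsMinOn (ftrlObjective α c β) (openSimplex K) x)
    (exists_isMinOn_ftrlObjective hK hα c hβ)

/-- The symmetrized divergence equals `(x - q) ^ 2 / (x q)`. This is the strong convexity of the
barrier on the unit interval. -/
theorem logDiv_add_logDiv {x q : ℝ} (hx : 0 < x) (hx1 : x < 1) (hq : 0 < q) (hq1 : q < 1) :
    (x - q) ^ 2 ≤ logDiv x q + logDiv q x := by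
  have : logDiv x q + logDiv q x = (x - q) ^ 2 / (x * q) := by
    unfold logDiv
    rw [Real.log_div hx.ne' hq.ne', Real.log_div hq.ne' hx.ne']
    field_simp; ring
  rw [this, le_div_iff₀ (by positivity)]
  have : x * q ≤ 1 := by nlinarith
  nlinarith [sq_nonneg (x - q)]

/-- The regularized leader depends Hölder-continuously on the parameters. -/
theorem leader_sub_sq_le {α : ℝ} (hK : 2 ≤ K) (hα : 0 < α) (hα1 : α < 1)
    {c c' β β' : Fin K → ℝ} (hβ : ∀ i, 0 ≤ β i) (hβ' : ∀ i, 0 ≤ β' i) :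
    ∑ i, (leader α c β i - leader α c' β' i) ^ 2
      ≤ ∑ i, (|c i - c' i| + 1 / α * |β i - β' i|) := by
  have hγ := six_le_barrier α
  obtain ⟨hq, hqm⟩ := leader_spec hK hα c hβ
  obtain ⟨hq', hqm'⟩ := leader_spec hK hα c' hβ'
  set q := leader α c β
  set q' := leader α c' β'
  -- Each minimizer is tested against the other. In the sum of the two inequalities only differences
  -- of the parameters survive, weighted by quantities that are bounded because `entropy` lies in
  -- `[-1/α, 0]`.
  have h1 := IsMinOn.bregman_le hK hα hq hqm hq'
  have h2 := IsMinOn.bregman_le hK hα hq' hqm' hq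
  simp only [ftrlObjective_eq] at h1 h2
  have h3 := add_le_add h1 h2
  rw [← Finset.sum_add_distrib, ← Finset.sum_add_distrib, ← Finset.sum_add_distrib,
    ← Finset.sum_add_distrib, ← sub_nonneg, ← Finset.sum_sub_distrib] at h3
  rw [← sub_nonneg, ← Finset.sum_sub_distrib]
  refine h3.trans (Finset.sum_le_sum fun i _ => ?_)
  have a1 := hq.2 i
  have a2 := lt_one_of_mem_openSimplex hK hq i
  have b1 := hq'.2 i
  have b2 := lt_one_of_mem_openSimplex hK hq' i
  have d1 := mul_nonneg (hβ i) (entropyDiv_nonneg hα hα1 b1 b2 a1 a2)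
  have d2 := mul_nonneg (hβ' i) (entropyDiv_nonneg hα hα1 a1 a2 b1 b2)
  have d3 := logDiv_add_logDiv a1 a2 b1 b2
  have d4 : logDiv (q i) (q' i) + logDiv (q' i) (q i) ≤
      barrier α * (logDiv (q i) (q' i) + logDiv (q' i) (q i)) :=
    le_mul_of_one_le_left ((sq_nonneg _).trans d3) (by linarith)
  have e1 : (c i - c' i) * (q' i - q i) ≤ |c i - c' i| := by
    refine (le_abs_self _).trans ?_
    rw [abs_mul]
    exact mul_le_of_le_one_right (abs_nonneg _) (abs_le.2 ⟨by linarith, by linarith⟩)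
  have hent : ∀ x : ℝ, 0 < x → x < 1 → -(1 / α) ≤ entropy α x ∧ entropy α x ≤ 0 :=
    fun x hx hx1 => by
      refine ⟨le_trans (neg_le_neg ?_) (neg_rpow_div_le_entropy hx1),
        entropy_nonpos hα hα1 hx hx1⟩
      gcongr
      exact Real.rpow_le_one hx.le hx1.le hα.le
  have e2 : (β i - β' i) * (entropy α (q' i) - entropy α (q i)) ≤ 1 / α * |β i - β' i| := by
    refine (le_abs_self _).trans ?_
    rw [abs_mul, mul_comm]
    refine mul_le_mul_of_nonneg_right ?_ (abs_nonneg _)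
    obtain ⟨u1, u2⟩ := hent _ a1 a2
    obtain ⟨v1, v2⟩ := hent _ b1 b2
    exact abs_le.2 ⟨by linarith, by linarith⟩
  unfold coordObjective
  linarith

/-- The minimizer is obtained by choice, so measurability in the losses is not automatic; in the
stochastic regime it follows from this continuity. -/
theorem continuous_leader {X : Type*} [TopologicalSpace X] {α : ℝ} (hK : 2 ≤ K) (hα : 0 < α)
    (hα1 : α < 1) {c β : X → Fin K → ℝ} (hc : ∀ i, Continuous fun x => c x i)
    (hβ : ∀ i, Continuous fun x => β x i) (hβ0 : ∀ x i, 0 ≤ β x i) (i : Fin K) :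
    Continuous fun x => leader α (c x) (β x) i := by
  rw [continuous_iff_continuousAt]
  intro x₀
  set q := fun x => leader α (c x) (β x) i
  have hlim : Tendsto (fun x => ∑ j, (|c x j - c x₀ j| + 1 / α * |β x j - β x₀ j|)) (𝓝 x₀)
      (𝓝 0) := by
    have hcont : Continuous fun x => ∑ j, (|c x j - c x₀ j| + 1 / α * |β x j - β x₀ j|) := by
      fun_prop
    simpa using hcont.tendsto x₀
  have hsq : Tendsto (fun x => (q x - q x₀) ^ 2) (𝓝 x₀) (𝓝 0) := by
    refine squeeze_zero (fun _ => sq_nonneg _) (fun x => ?_) hlim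
    refine le_trans ?_ (leader_sub_sq_le hK hα hα1 (hβ0 x) (hβ0 x₀))
    exact Finset.single_le_sum
      (f := fun j => (leader α (c x) (β x) j - leader α (c x₀) (β x₀) j) ^ 2)
      (fun j _ => sq_nonneg _) (Finset.mem_univ i)
  have habs : Tendsto (fun x => |q x - q x₀|) (𝓝 x₀) (𝓝 0) := by
    have := hsq.sqrt
    simpa [Real.sqrt_sq_eq_abs] using this
  exact tendsto_sub_nhds_zero_iff.1 (tendsto_zero_iff_abs_tendsto_zero _ |>.2 habs)

end

section

/-! ### One round of coordinate-wise SPM -/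

open CoWSPM Filter Topology

variable {K T : ℕ} {α : ℝ}

/-- The standing assumptions on the numbers of arms and rounds and on the parameter. -/
structure Setting (K T : ℕ) (α : ℝ) : Prop where
  pos : 0 < α
  lt_one : α < 1
  arms : 4 ≤ K
  rounds : 4 * K ≤ T

namespace Setting

theorem one_sub_pos (S : Setting K T α) : 0 < 1 - α := sub_pos.2 S.lt_one

theorem two_le (S : Setting K T α) : 2 ≤ K := by have := S.arms; omega

theorem four_le_cast (S : Setting K T α) : (4 : ℝ) ≤ K := by exact_mod_cast S.arms

theorem rounds_cast (S : Setting K T α) : 4 * (K : ℝ) ≤ T := by exact_mod_cast S.rounds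

theorem sixteen_le_cast (S : Setting K T α) : (16 : ℝ) ≤ T := by
  have h1 := S.four_le_cast
  have h2 := S.rounds_cast
  linarith

theorem cast_pos (S : Setting K T α) : (0 : ℝ) < T := by linarith [S.sixteen_le_cast]

theorem ratio_le (S : Setting K T α) : (K : ℝ) / T ≤ 1 / 4 := by
  rw [div_le_div_iff₀ S.cast_pos (by norm_num)]
  linarith [S.rounds_cast]

theorem ratio_nonneg (S : Setting K T α) : 0 ≤ (K : ℝ) / T :=
  div_nonneg (Nat.cast_nonneg _) S.cast_pos.le

theorem arms_le_start_rate (S : Setting K T α) : 32 ≤ 8 * (K : ℝ) / (1 - α) := by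
  rw [le_div_iff₀ S.one_sub_pos]
  nlinarith [S.four_le_cast, S.pos]

end Setting

/-- `iterate` is by definition a `leader` whose linear part is the prediction added to the
cumulative estimate. -/
theorem iterate_spec (S : Setting K T α) {s : CoWSPMState K} (hs : ∀ i, 0 ≤ s.rate i) :
    iterate α s ∈ openSimplex K ∧
      IsMinOn (ftrlObjective α (fun i => prediction s i + s.cumEst i) s.rate) (openSimplex K)
        (iterate α s) :=
  leader_spec S.two_le S.pos _ hs

section Sampling

variable {s : CoWSPMState K}

theorem one_div_le_sampling (S : Setting K T α) (hs : ∀ i, 0 ≤ s.rate i) (i : Fin K) :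
    1 / (T : ℝ) ≤ sampling T α s i := by
  have h := (iterate_spec S hs).1.2 i
  have := S.ratio_le
  unfold sampling
  nlinarith

theorem sampling_pos (S : Setting K T α) (hs : ∀ i, 0 ≤ s.rate i) (i : Fin K) :
    0 < sampling T α s i :=
  (one_div_pos.2 S.cast_pos).trans_le (one_div_le_sampling S hs i)

theorem sum_sampling (S : Setting K T α) (hs : ∀ i, 0 ≤ s.rate i) :
    ∑ i, sampling T α s i = 1 := by
  have h := (iterate_spec S hs).1.1.2
  unfold sampling
  rw [Finset.sum_add_distrib, ← Finset.mul_sum, h]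
  simp
  ring

theorem iterate_le_sampling (S : Setting K T α) (hs : ∀ i, 0 ≤ s.rate i) (i : Fin K) :
    3 / 4 * iterate α s i ≤ sampling T α s i := by
  have h := (iterate_spec S hs).1.2 i
  have := S.ratio_le
  have h2 : 0 < 1 / (T : ℝ) := one_div_pos.2 S.cast_pos
  unfold sampling
  nlinarith

theorem one_sub_iterate_le (S : Setting K T α) (hs : ∀ i, 0 ≤ s.rate i) (i : Fin K) :
    3 / 4 * (1 - iterate α s i) ≤ 1 - sampling T α s i := by
  have h := lt_one_of_mem_openSimplex S.two_le (iterate_spec S hs).1 i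
  have h1 := S.ratio_le
  have h2 : 1 / (T : ℝ) ≤ K / T := by
    have := S.cast_pos
    gcongr
    linarith [S.four_le_cast]
  unfold sampling
  nlinarith

theorem sampling_lt_one (S : Setting K T α) (hs : ∀ i, 0 ≤ s.rate i) (i : Fin K) :
    sampling T α s i < 1 := by
  have h := lt_one_of_mem_openSimplex S.two_le (iterate_spec S hs).1 i
  have := one_sub_iterate_le S hs i
  linarith

theorem penalty_pos (S : Setting K T α) (hs : ∀ i, 0 ≤ s.rate i) (i : Fin K) :
    0 < penalty T α s i :=
  mul_pos (one_div_pos.2 S.pos) (Real.rpow_pos_of_pos (sampling_pos S hs i) _)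

theorem penalty_le (S : Setting K T α) (hs : ∀ i, 0 ≤ s.rate i) (i : Fin K) :
    penalty T α s i ≤ 1 / α :=
  mul_le_of_le_one_right (one_div_pos.2 S.pos).le
    (Real.rpow_le_one (sampling_pos S hs i).le (sampling_lt_one S hs i).le S.pos.le)

theorem stability_eq_stab (T : ℕ) (α : ℝ) (s : CoWSPMState K) (i : Fin K) (y : ℝ) :
    stability T α s i y = stab α (s.rate i) (sampling T α s i) (y - prediction s i) := rfl

theorem stability_nonneg (S : Setting K T α) (hs : ∀ i, 0 ≤ s.rate i) (i : Fin K) (y : ℝ) :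
    0 ≤ stability T α s i y :=
  stab_nonneg S.pos S.lt_one (hs i) (sampling_pos S hs i) (sampling_lt_one S hs i).le

end Sampling

/-- The properties of the states that are reached after `n` rounds with losses in `[0, 1]`. -/
structure Admissible (T : ℕ) (α : ℝ) (n : ℕ) (s : CoWSPMState K) : Prop where
  start_le_rate : ∀ i, 8 * (K : ℝ) / (1 - α) ≤ s.rate i
  rate_le : ∀ i, s.rate i ≤ 8 * (K : ℝ) / (1 - α) + 12 * T * n
  lossSum_nonneg : ∀ i, 0 ≤ s.lossSum i
  lossSum_le : ∀ i, s.lossSum i ≤ s.count i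
  count_le : ∀ i, s.count i ≤ n

section Admissible

variable {s : CoWSPMState K} {n : ℕ}

theorem Admissible.two_le_rate (S : Setting K T α) (hs : Admissible T α n s) (i : Fin K) :
    2 ≤ s.rate i := by
  linarith [hs.start_le_rate i, S.arms_le_start_rate]

theorem Admissible.rate_nonneg (S : Setting K T α) (hs : Admissible T α n s) (i : Fin K) :
    0 ≤ s.rate i := by
  linarith [hs.two_le_rate S i]

theorem Admissible.prediction_mem (hs : Admissible T α n s) (i : Fin K) :
    0 ≤ prediction s i ∧ prediction s i ≤ 1 := by
  have h1 := hs.lossSum_nonneg i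
  have h2 := hs.lossSum_le i
  have h3 : (0 : ℝ) < 1 + s.count i := by positivity
  unfold prediction
  exact ⟨by positivity, by rw [div_le_one h3]; linarith⟩

theorem Admissible.abs_sub_prediction_le (hs : Admissible T α n s) (i : Fin K) {y : ℝ}
    (hy : y ∈ Set.Icc (0 : ℝ) 1) : |y - prediction s i| ≤ 1 := by
  obtain ⟨h1, h2⟩ := hs.prediction_mem i
  exact abs_le.2 ⟨by linarith [hy.1], by linarith [hy.2]⟩

theorem Admissible.stability_div_rate_le (S : Setting K T α) (hs : Admissible T α n s)
    (i : Fin K) {y : ℝ} (hy : y ∈ Set.Icc (0 : ℝ) 1) :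
    stability T α s i y / s.rate i ≤ 12 := by
  refine (stab_div_le (by linarith [hs.two_le_rate S i]) (hs.abs_sub_prediction_le i hy)).trans ?_
  have := six_le_barrier α
  rw [div_le_iff₀ (by linarith)]
  linarith

theorem admissible_start : Admissible T α 0 (start K α) where
  start_le_rate _ := le_rfl
  rate_le _ := by simp [start]
  lossSum_nonneg _ := le_rfl
  lossSum_le _ := by simp [start]
  count_le _ := le_rfl

theorem Admissible.update (S : Setting K T α) (hs : Admissible T α n s) (I : Fin K) {y : ℝ}
    (hy : y ∈ Set.Icc (0 : ℝ) 1) : Admissible T α (n + 1) (update T α s I y) := by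
  have hr := hs.rate_nonneg S
  have hinc : ∀ i, 0 ≤ (if I = i then stability T α s i y else 0)
      / (s.rate i * penalty T α s i) := fun i => by
    have h1 := penalty_pos S hr i
    have h2 := hr i
    split_ifs
    · have := stability_nonneg S hr i y
      positivity
    · simp
  refine ⟨fun i => ?_, fun i => ?_, fun i => ?_, fun i => ?_, fun i => ?_⟩
  · exact (hs.start_le_rate i).trans (le_add_of_nonneg_right (hinc i))
  · have h1 := hs.rate_le i
    have hT := S.cast_pos
    -- Exploration gives `h ≥ p ≥ 1 / T`, and `z / β ≤ 12`.
    have h2 : (if I = i then stability T α s i y else 0) / (s.rate i * penalty T α s i)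
        ≤ 12 * T := by
      split_ifs
      · have h3 := hs.stability_div_rate_le S i hy
        have h4 : 1 / penalty T α s i ≤ T := by
          have h5 : 1 / (T : ℝ) ≤ penalty T α s i := by
            unfold penalty
            have hp := sampling_pos S hr i
            calc 1 / (T : ℝ) ≤ sampling T α s i := one_div_le_sampling S hr i
              _ ≤ sampling T α s i ^ α := by
                  simpa using Real.rpow_le_rpow_of_exponent_ge hp (sampling_lt_one S hr i).le
                    S.lt_one.le
              _ ≤ 1 / α * sampling T α s i ^ α := by
                  refine le_mul_of_one_le_left (by positivity) ?_
                  rw [le_div_iff₀ S.pos]; linarith [S.lt_one]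
          rw [div_le_iff₀ (penalty_pos S hr i)]
          rw [div_le_iff₀ hT] at h5
          linarith
        have h6 := penalty_pos S hr i
        calc _ = stability T α s i y / s.rate i * (1 / penalty T α s i) := by
              field_simp
          _ ≤ 12 * T := by gcongr
      · simp
    push_cast
    change s.rate i + _ ≤ _
    linarith
  · change 0 ≤ s.lossSum i + _
    have h1 := hs.lossSum_nonneg i
    have h2 := hy.1
    split_ifs <;> linarith
  · change s.lossSum i + _ ≤ ((s.count i + _ : ℕ) : ℝ)
    have h1 := hs.lossSum_le i
    have h2 := hy.2
    split_ifs <;> push_cast <;> linarith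
  · change s.count i + _ ≤ _
    have h1 := hs.count_le i
    split_ifs <;> omega

end Admissible

/-- The importance-weighted loss estimate of arm `i` after arm `I` was drawn and its loss `y`
observed. -/
def lossEstimate (T : ℕ) (α : ℝ) (s : CoWSPMState K) (I : Fin K) (y : ℝ) (i : Fin K) : ℝ :=
  prediction s i + if I = i then (y - prediction s i) / sampling T α s i else 0

theorem update_cumEst (T : ℕ) (α : ℝ) (s : CoWSPMState K) (I : Fin K) (y : ℝ) (i : Fin K) :
    (update T α s I y).cumEst i = s.cumEst i + lossEstimate T α s I y i := rfl

/-- The estimates are unbiased. -/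
theorem sum_sampling_mul_lossEstimate (S : Setting K T α) {s : CoWSPMState K}
    (hs : ∀ i, 0 ≤ s.rate i) (y : Fin K → ℝ) (j : Fin K) :
    ∑ i, sampling T α s i * lossEstimate T α s i (y i) j = y j := by
  unfold lossEstimate
  simp only [mul_add, Finset.sum_add_distrib, ← Finset.sum_mul, sum_sampling S hs, mul_ite,
    mul_zero, Finset.sum_ite_eq', Finset.mem_univ, if_true]
  have := (sampling_pos S hs j).ne'
  field_simp
  ring

/-- The value of the regularized leader without prediction. -/
def leaderValue (α : ℝ) (s : CoWSPMState K) : ℝ :=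
  ftrlObjective α s.cumEst s.rate (leader α s.cumEst s.rate)

theorem leaderValue_le (S : Setting K T α) {s : CoWSPMState K} (hs : ∀ i, 0 ≤ s.rate i)
    {x : Fin K → ℝ} (hx : x ∈ openSimplex K) :
    leaderValue α s ≤ ftrlObjective α s.cumEst s.rate x :=
  (leader_spec S.two_le S.pos s.cumEst hs).2 hx

/-- One round of optimistic follow-the-regularized-leader. -/
theorem leaderValue_add_le (S : Setting K T α) {s : CoWSPMState K} {n : ℕ}
    (hs : Admissible T α n s) (I : Fin K) {y : ℝ} (hy : y ∈ Set.Icc (0 : ℝ) 1) :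
    leaderValue α s + ∑ i, lossEstimate T α s I y i * iterate α s i
      ≤ leaderValue α (update T α s I y) + 8 * (stability T α s I y / s.rate I) := by
  have hr := hs.rate_nonneg S
  have hr' := (hs.update S I hy).rate_nonneg S
  set s' := update T α s I y with hs'
  obtain ⟨hx, -⟩ := leader_spec S.two_le S.pos s'.cumEst hr'
  obtain ⟨hq, hqm⟩ := iterate_spec S hr
  -- The old leader is replaced by the optimistic iterate `q`, for which the linear terms of the two
  -- rounds can be compared.
  have hstart := leaderValue_le S hr hq
  rw [show leaderValue α s' = ftrlObjective α s'.cumEst s'.rate (leader α s'.cumEst s'.rate)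
    from rfl]
  set x := leader α s'.cumEst s'.rate
  set q := iterate α s
  set c : Fin K → ℝ := fun i => prediction s i + s.cumEst i
  have hx1 := lt_one_of_mem_openSimplex S.two_le hx
  have hq1 := lt_one_of_mem_openSimplex S.two_le hq
  have hbreg := IsMinOn.bregman_le S.two_le S.pos hq hqm hx
  have hD : s.rate I * entropyDiv α (x I) (q I) + barrier α * logDiv (x I) (q I)
      ≤ ∑ i, (s.rate i * entropyDiv α (x i) (q i) + barrier α * logDiv (x i) (q i)) :=
    Finset.single_le_sum
      (f := fun i => s.rate i * entropyDiv α (x i) (q i) + barrier α * logDiv (x i) (q i))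
      (fun i _ => add_nonneg
        (mul_nonneg (hr i) (entropyDiv_nonneg S.pos S.lt_one (hx.2 i) (hx1 i) (hq.2 i) (hq1 i)))
        (mul_nonneg (by linarith [six_le_barrier α]) (logDiv_nonneg (hx.2 i) (hq.2 i))))
      (Finset.mem_univ I)
  have hround := round_bound S.pos S.lt_one (hs.two_le_rate S I) (hx.2 I) (hx1 I) (hq.2 I) (hq1 I)
    (sampling_pos S hr I) (sampling_lt_one S hr I) (iterate_le_sampling S hr I)
    (one_sub_iterate_le S hr I) (hs.abs_sub_prediction_le I hy)
  rw [← stability_eq_stab] at hround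
  -- The prediction is contained in the loss estimate, so the new objective differs from the
  -- optimistic one only in the drawn coordinate.
  have hexp : ftrlObjective α s'.cumEst s'.rate x = ftrlObjective α c s.rate x
      + (y - prediction s I) / sampling T α s I * x I
      + stability T α s I y / (s.rate I * (1 / α * sampling T α s I ^ α)) * entropy α (x I) := by
    have hg : (y - prediction s I) / sampling T α s I * x I = ∑ i,
        (if I = i then (y - prediction s i) / sampling T α s i else 0) * x i := by
      simp [ite_mul]
    have hd : stability T α s I y / (s.rate I * (1 / α * sampling T α s I ^ α))
        * entropy α (x I) = ∑ i, ((if I = i then stability T α s i y else 0)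
          / (s.rate i * penalty T α s i)) * entropy α (x i) := by
      simp [ite_mul, ite_div, penalty]
    rw [hg, hd, ftrlObjective_eq, ftrlObjective_eq, ← Finset.sum_add_distrib,
      ← Finset.sum_add_distrib]
    refine Finset.sum_congr rfl fun i _ => ?_
    simp only [hs', update, coordObjective, c]
    ring
  have hq' : ftrlObjective α c s.rate q
      = ftrlObjective α s.cumEst s.rate q + ∑ i, prediction s i * q i := by
    unfold ftrlObjective
    simp only [c, add_mul, Finset.sum_add_distrib]
    ring
  have hest : ∑ i, lossEstimate T α s I y i * q i
      = ∑ i, prediction s i * q i + (y - prediction s I) / sampling T α s I * q I := by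
    unfold lossEstimate
    simp [add_mul, Finset.sum_add_distrib, ite_mul]
  linarith

end

section

/-! ### Expectations over the draws of the algorithm -/

open CoWSPM Filter Topology

variable {K T : ℕ} {α : ℝ} {ℓ : ℕ → Fin K → ℝ}

/-- The expectation of a function of the state after `n` rounds. -/
def expect (T : ℕ) (α : ℝ) (ℓ : ℕ → Fin K → ℝ) : ℕ → (CoWSPMState K → ℝ) → ℝ
  | 0, Φ => Φ (start K α)
  | n + 1, Φ => expect T α ℓ n fun s => ∑ i, sampling T α s i * Φ (update T α s i (ℓ n i))

theorem expect_sum {ι : Type*} (A : Finset ι) (n : ℕ) (Φ : ι → CoWSPMState K → ℝ) :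
    expect T α ℓ n (fun s => ∑ j ∈ A, Φ j s) = ∑ j ∈ A, expect T α ℓ n (Φ j) := by
  induction n generalizing Φ with
  | zero => rfl
  | succ n ih =>
    simp only [expect]
    rw [← ih]
    congr 1
    ext s
    simp only [Finset.mul_sum]
    exact Finset.sum_comm

theorem expect_add (n : ℕ) (Φ Ψ : CoWSPMState K → ℝ) :
    expect T α ℓ n (fun s => Φ s + Ψ s) = expect T α ℓ n Φ + expect T α ℓ n Ψ := by
  have := expect_sum (T := T) (α := α) (ℓ := ℓ) Finset.univ n ![Φ, Ψ]
  simpa [Fin.sum_univ_two] using this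

theorem expect_const_mul (n : ℕ) (c : ℝ) (Φ : CoWSPMState K → ℝ) :
    expect T α ℓ n (fun s => c * Φ s) = c * expect T α ℓ n Φ := by
  induction n generalizing Φ with
  | zero => rfl
  | succ n ih =>
    simp only [expect]
    rw [← ih]
    congr 1
    ext s
    rw [Finset.mul_sum]
    exact Finset.sum_congr rfl fun i _ => by ring

theorem expect_sub (n : ℕ) (Φ Ψ : CoWSPMState K → ℝ) :
    expect T α ℓ n (fun s => Φ s - Ψ s) = expect T α ℓ n Φ - expect T α ℓ n Ψ := by
  have h := expect_add (T := T) (α := α) (ℓ := ℓ) n Φ fun s => -1 * Ψ s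
  rw [expect_const_mul] at h
  rw [sub_eq_add_neg, neg_eq_neg_one_mul, ← h]
  congr 1
  ext s
  ring

theorem expect_mono (S : Setting K T α) (hℓ : ∀ n i, ℓ n i ∈ Set.Icc (0 : ℝ) 1) {n : ℕ}
    {Φ Ψ : CoWSPMState K → ℝ} (h : ∀ s, Admissible T α n s → Φ s ≤ Ψ s) :
    expect T α ℓ n Φ ≤ expect T α ℓ n Ψ := by
  induction n generalizing Φ Ψ with
  | zero => exact h _ admissible_start
  | succ n ih =>
    exact ih fun s hs => Finset.sum_le_sum fun i _ =>
      mul_le_mul_of_nonneg_left (h _ (hs.update S i (hℓ n i)))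
        (sampling_pos S (hs.rate_nonneg S) i).le

theorem expect_congr (S : Setting K T α) (hℓ : ∀ n i, ℓ n i ∈ Set.Icc (0 : ℝ) 1) {n : ℕ}
    {Φ Ψ : CoWSPMState K → ℝ} (h : ∀ s, Admissible T α n s → Φ s = Ψ s) :
    expect T α ℓ n Φ = expect T α ℓ n Ψ :=
  le_antisymm (expect_mono S hℓ fun s hs => (h s hs).le)
    (expect_mono S hℓ fun s hs => (h s hs).ge)

theorem expect_const (S : Setting K T α) (hℓ : ∀ n i, ℓ n i ∈ Set.Icc (0 : ℝ) 1) (n : ℕ)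
    (c : ℝ) : expect T α ℓ n (fun _ => c) = c := by
  induction n with
  | zero => rfl
  | succ n ih =>
    simp only [expect]
    conv_rhs => rw [← ih]
    refine expect_congr S hℓ fun s hs => ?_
    rw [← Finset.sum_mul, sum_sampling S (hs.rate_nonneg S), one_mul]

theorem expect_nonneg (S : Setting K T α) (hℓ : ∀ n i, ℓ n i ∈ Set.Icc (0 : ℝ) 1) {n : ℕ}
    {Φ : CoWSPMState K → ℝ} (h : ∀ s, Admissible T α n s → 0 ≤ Φ s) :
    0 ≤ expect T α ℓ n Φ := by
  rw [← expect_const S hℓ n 0]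
  exact expect_mono S hℓ h

/-- Summing a lower bound for the expected one-step increments of a potential. -/
theorem sum_expect_le (S : Setting K T α) (hℓ : ∀ n i, ℓ n i ∈ Set.Icc (0 : ℝ) 1)
    (A : ℕ → CoWSPMState K → ℝ) (Φ : CoWSPMState K → ℝ)
    (h : ∀ n s, Admissible T α n s →
      A n s ≤ ∑ i, sampling T α s i * (Φ (update T α s i (ℓ n i)) - Φ s)) (N : ℕ) :
    ∑ n ∈ Finset.range N, expect T α ℓ n (A n) ≤ expect T α ℓ N Φ - Φ (start K α) := by
  induction N with
  | zero => simp [expect]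
  | succ N ih =>
    rw [Finset.sum_range_succ]
    have h1 : expect T α ℓ N (A N) ≤ expect T α ℓ (N + 1) Φ - expect T α ℓ N Φ := by
      rw [expect, ← expect_sub]
      refine expect_mono S hℓ fun s hs => (h N s hs).trans (le_of_eq ?_)
      simp only [mul_sub, Finset.sum_sub_distrib, ← Finset.sum_mul,
        sum_sampling S (hs.rate_nonneg S), one_mul]
    linarith

/-- The list of all drawn arms and observed losses. -/
def fullHistory {n : ℕ} (ℓ : Fin n → Fin K → ℝ) (I : Fin n → Fin K) : List (Fin K × ℝ) :=
  (List.finRange n).map fun s => (I s, ℓ s (I s))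

theorem history_snoc_castSucc {n : ℕ} (ℓ : Fin (n + 1) → Fin K → ℝ) (I : Fin n → Fin K)
    (i : Fin K) (t : Fin n) :
    history ℓ (Fin.snoc I i : Fin (n + 1) → Fin K) t.castSucc
      = history (fun t => ℓ t.castSucc) I t := by
  unfold history
  rw [List.finRange_succ_last, List.take_append_of_le_length (by simp), ← List.map_take,
    List.map_map]
  simp [Function.comp_def]

theorem history_snoc_last {n : ℕ} (ℓ : Fin (n + 1) → Fin K → ℝ) (I : Fin n → Fin K)
    (i : Fin K) :
    history ℓ (Fin.snoc I i : Fin (n + 1) → Fin K) (Fin.last n)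
      = fullHistory (fun t => ℓ t.castSucc) I := by
  unfold history fullHistory
  rw [List.finRange_succ_last, List.take_append_of_le_length (by simp)]
  simp [Function.comp_def]

theorem fullHistory_snoc {n : ℕ} (ℓ : Fin (n + 1) → Fin K → ℝ) (I : Fin n → Fin K) (i : Fin K) :
    fullHistory ℓ (Fin.snoc I i : Fin (n + 1) → Fin K)
      = fullHistory (fun t => ℓ t.castSucc) I ++ [(i, ℓ (Fin.last n) i)] := by
  unfold fullHistory
  rw [List.finRange_succ_last]
  simp [Function.comp_def]

theorem trajProb_snoc {n : ℕ} (π : Policy K) (ℓ : Fin (n + 1) → Fin K → ℝ) (I : Fin n → Fin K)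
    (i : Fin K) :
    trajProb π ℓ (Fin.snoc I i : Fin (n + 1) → Fin K)
      = trajProb π (fun t => ℓ t.castSucc) I * π (fullHistory (fun t => ℓ t.castSucc) I) i := by
  unfold trajProb
  rw [Fin.prod_univ_castSucc, history_snoc_last]
  simp [history_snoc_castSucc]

theorem state_append (T : ℕ) (α : ℝ) (h : List (Fin K × ℝ)) (i : Fin K) (y : ℝ) :
    state T α (h ++ [(i, y)]) = update T α (state T α h) i y := by
  simp [state]

/-- Splitting off the last draw matches the sum over trajectories with the recursion of `expect`, so
all later estimates can be made state by state. -/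
theorem sum_trajProb_mul (n : ℕ) (Φ : CoWSPMState K → ℝ) :
    ∑ I : Fin n → Fin K, trajProb (coWSPM K T α) (fun t : Fin n => ℓ t) I
        * Φ (state T α (fullHistory (fun t : Fin n => ℓ t) I))
      = expect T α ℓ n Φ := by
  induction n generalizing Φ with
  | zero => simp [trajProb, expect, fullHistory, state]
  | succ n ih =>
    rw [expect, ← ih, ← (Fin.snocEquiv fun _ : Fin (n + 1) => Fin K).sum_comp,
      Fintype.sum_prod_type_right]
    refine Finset.sum_congr rfl fun I _ => ?_
    rw [Finset.mul_sum]
    refine Finset.sum_congr rfl fun i _ => ?_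
    change trajProb (coWSPM K T α) _ (Fin.snoc I i : Fin (n + 1) → Fin K)
      * Φ (state T α (fullHistory _ (Fin.snoc I i : Fin (n + 1) → Fin K))) = _
    rw [trajProb_snoc, fullHistory_snoc, state_append]
    simp only [Fin.val_castSucc, Fin.val_last, coWSPM]
    ring

/-- The learner's total loss can be read off the final state; this brings the regret into the form
handled by `expect`. -/
theorem sum_lossSum_state {n : ℕ} (ℓ : Fin n → Fin K → ℝ) (I : Fin n → Fin K) :
    ∑ i, (state T α (fullHistory ℓ I)).lossSum i = ∑ t, ℓ t (I t) := by
  have h : ∀ L : List (Fin K × ℝ), ∑ i, (state T α L).lossSum i = (L.map Prod.snd).sum := by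
    intro L
    induction L using List.reverseRecOn with
    | nil => simp [state, start]
    | append_singleton L x ih =>
      obtain ⟨i, y⟩ := x
      rw [state_append]
      simp [update, Finset.sum_add_distrib, ih]
  rw [h, fullHistory, List.map_map, Fin.sum_univ_def]
  rfl

theorem expect_lossSum_eq (S : Setting K T α) (hℓ : ∀ n i, ℓ n i ∈ Set.Icc (0 : ℝ) 1) (N : ℕ) :
    expect T α ℓ N (fun s => ∑ i, s.lossSum i)
      = ∑ n ∈ Finset.range N, expect T α ℓ n (fun s => ∑ i, sampling T α s i * ℓ n i) := by
  induction N with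
  | zero => simp [expect, start]
  | succ N ih =>
    rw [Finset.sum_range_succ, ← ih, expect, ← expect_add]
    refine expect_congr S hℓ fun s hs => ?_
    simp only [update, Finset.sum_add_distrib, Finset.sum_ite_eq, Finset.mem_univ, if_true,
      mul_add, ← Finset.sum_mul, sum_sampling S (hs.rate_nonneg S), one_mul]

/-- The pseudo-regret against a fixed arm as a sum over the rounds. -/
theorem regretAgainst_eq (S : Setting K T α) (hℓ : ∀ n i, ℓ n i ∈ Set.Icc (0 : ℝ) 1)
    (a : Fin K) :
    regretAgainst (coWSPM K T α) (fun t : Fin T => ℓ t) a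
      = ∑ n ∈ Finset.range T, expect T α ℓ n (fun s => ∑ i, sampling T α s i * ℓ n i)
        - ∑ n ∈ Finset.range T, ℓ n a := by
  rw [← expect_lossSum_eq S hℓ, ← sum_trajProb_mul, regretAgainst]
  have h1 : ∑ I : Fin T → Fin K, trajProb (coWSPM K T α) (fun t : Fin T => ℓ t) I = 1 := by
    have := sum_trajProb_mul (T := T) (α := α) (ℓ := ℓ) T fun _ => 1
    rw [expect_const S hℓ] at this
    simpa using this
  simp only [sum_lossSum_state, Finset.sum_sub_distrib, mul_sub, ← Finset.sum_mul, h1, one_mul]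
  rw [Fin.sum_univ_eq_sum_range (fun n => ℓ n a)]

end

section

/-! ### Regret in terms of the stability terms -/

open CoWSPM Filter Topology

variable {K T : ℕ} {α : ℝ} {ℓ : ℕ → Fin K → ℝ}

/-- Bernoulli's inequality applied to `K x_i`, that is, the tangent of the concave power at the
uniform point. -/
theorem sum_rpow_le {a : ℝ} (ha : 0 < a) (ha1 : a < 1) (hK : 0 < K) {x : Fin K → ℝ}
    (hx : ∀ i, 0 < x i) (hsum : ∑ i, x i = 1) : ∑ i, x i ^ a ≤ (K : ℝ) ^ (1 - a) := by
  have hK' : (0 : ℝ) < K := by exact_mod_cast hK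
  have hKa : 0 < (K : ℝ) ^ a := Real.rpow_pos_of_pos hK' a
  have h1 : ∑ i, (K : ℝ) ^ a * x i ^ a ≤ ∑ i, (1 + a * (K * x i - 1)) :=
    Finset.sum_le_sum fun i _ => by
      rw [← Real.mul_rpow hK'.le (hx i).le]
      exact rpow_le_one_add_mul ha ha1 (mul_pos hK' (hx i))
  have h2 : ∑ i, (1 + a * (K * x i - 1)) = (K : ℝ) := by
    simp only [Finset.sum_add_distrib, ← Finset.mul_sum, Finset.sum_sub_distrib, hsum]
    simp
  rw [← Finset.mul_sum, h2] at h1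
  rw [Real.rpow_sub hK', Real.rpow_one, le_div_iff₀ hKa]
  linarith

/-- The comparator that replaces the vertex `a` of the simplex. -/
def comparator (T : ℕ) (a i : Fin K) : ℝ := (1 - K / T) * (if a = i then 1 else 0) + 1 / T

theorem one_div_le_comparator (S : Setting K T α) (a i : Fin K) :
    1 / (T : ℝ) ≤ comparator T a i := by
  have := S.ratio_le
  unfold comparator
  split_ifs <;> linarith

theorem comparator_mem_openSimplex (S : Setting K T α) (a : Fin K) :
    comparator T a ∈ openSimplex K := by
  have hpos : ∀ i, 0 < comparator T a i := fun i =>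
    (one_div_pos.2 S.cast_pos).trans_le (one_div_le_comparator S a i)
  refine ⟨⟨fun i => (hpos i).le, ?_⟩, hpos⟩
  unfold comparator
  simp [Finset.sum_add_distrib]
  ring

theorem regularizer_comparator_le (S : Setting K T α) (a : Fin K) {β : Fin K → ℝ}
    (hβ : ∀ i, 0 ≤ β i) :
    regularizer α β (comparator T a) ≤ 48 / (1 - α) * (K * Real.log T) := by
  have hu := comparator_mem_openSimplex S a
  have h1 : ∑ i, β i * entropy α (comparator T a i) ≤ 0 :=
    Finset.sum_nonpos fun i _ => mul_nonpos_of_nonneg_of_nonpos (hβ i)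
      (entropy_nonpos S.pos S.lt_one (hu.2 i) (lt_one_of_mem_openSimplex S.two_le hu i))
  have h2 : ∑ _i : Fin K, -Real.log T ≤ ∑ i, Real.log (comparator T a i) :=
    Finset.sum_le_sum fun i _ => by
      have := Real.log_le_log (one_div_pos.2 S.cast_pos) (one_div_le_comparator S a i)
      rwa [one_div, Real.log_inv] at this
  simp only [Finset.sum_const, Finset.card_univ, Fintype.card_fin, nsmul_eq_mul] at h2
  have hlog : 0 ≤ Real.log T := Real.log_nonneg (by linarith [S.sixteen_le_cast])
  have h3 : barrier α * (K * Real.log T) ≤ 48 / (1 - α) * (K * Real.log T) :=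
    mul_le_mul_of_nonneg_right (barrier_le S.pos S.lt_one) (by positivity)
  have h4 : barrier α * (-(K * Real.log T))
      ≤ barrier α * ∑ i, Real.log (comparator T a i) :=
    mul_le_mul_of_nonneg_left (by linarith) (by linarith [six_le_barrier α])
  unfold regularizer
  unfold entropy at h1
  linarith

/-- The barrier and the Shannon part are nonnegative, so only the Tsallis entropy with the initial
rate counts. This produces the term `K ^ (2 - α)`. -/
theorem le_leaderValue_start (S : Setting K T α) :
    -(8 * (K : ℝ) ^ (2 - α) / (α * (1 - α))) ≤ leaderValue α (start K α) := by
  have hK : (0 : ℝ) < K := by linarith [S.four_le_cast]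
  have hα' := S.one_sub_pos
  have hr : ∀ i, 0 ≤ (start K α).rate i := fun i => by
    simp only [start]; positivity
  obtain ⟨hx, -⟩ := leader_spec S.two_le S.pos (start K α).cumEst hr
  unfold leaderValue
  set x := leader α (start K α).cumEst (start K α).rate
  rw [ftrlObjective_eq]
  have h1 : ∀ i, -(8 * K / (1 - α) * (x i ^ α / α))
      ≤ coordObjective α ((start K α).cumEst i) ((start K α).rate i) (x i) := fun i => by
    have h2 := lt_one_of_mem_openSimplex S.two_le hx i
    have h3 := mul_le_mul_of_nonneg_left (neg_rpow_div_le_entropy (α := α) h2) (hr i)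
    have h4 : barrier α * Real.log (x i) ≤ 0 :=
      mul_nonpos_of_nonneg_of_nonpos (by linarith [six_le_barrier α])
        (Real.log_nonpos (hx.2 i).le h2.le)
    unfold coordObjective
    simp only [start] at *
    linarith
  refine le_trans ?_ (Finset.sum_le_sum fun i _ => h1 i)
  rw [Finset.sum_neg_distrib, ← Finset.mul_sum, ← Finset.sum_div]
  refine neg_le_neg ?_
  have h5 := sum_rpow_le S.pos S.lt_one (by have := S.arms; omega) hx.2 hx.1.2
  have h6 : (K : ℝ) ^ (2 - α) = K * (K : ℝ) ^ (1 - α) := by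
    rw [show 2 - α = 1 + (1 - α) by ring, Real.rpow_add hK, Real.rpow_one]
  have hα := S.pos
  calc 8 * K / (1 - α) * ((∑ i, x i ^ α) / α)
      ≤ 8 * K / (1 - α) * ((K : ℝ) ^ (1 - α) / α) := by gcongr
    _ = _ := by rw [h6]; field_simp

/-- The expected regret is bounded by the expected sum of the stability terms. -/
theorem regret_le_sum_stability (S : Setting K T α) (hℓ : ∀ n i, ℓ n i ∈ Set.Icc (0 : ℝ) 1)
    (a : Fin K) :
    ∑ n ∈ Finset.range T, expect T α ℓ n (fun s => ∑ i, sampling T α s i * ℓ n i)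
        - ∑ n ∈ Finset.range T, ℓ n a
      ≤ 2 * K + 48 / (1 - α) * (K * Real.log T) + 8 * (K : ℝ) ^ (2 - α) / (α * (1 - α))
        + 8 * ∑ n ∈ Finset.range T, expect T α ℓ n
          (fun s => ∑ i, sampling T α s i * (stability T α s i (ℓ n i) / s.rate i)) := by
  set u := comparator T a with hu
  have hTpos := S.cast_pos
  have hrat := S.ratio_le
  have hrat0 := S.ratio_nonneg
  set Z : ℕ → CoWSPMState K → ℝ := fun n s =>
    ∑ i, sampling T α s i * (stability T α s i (ℓ n i) / s.rate i) with hZ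
  -- The summand `2 K / T` covers two replacements: `p` by `q` and the vertex `a` by `u`.
  have htel := sum_expect_le S hℓ
    (fun n s => (∑ i, sampling T α s i * ℓ n i) - (ℓ n a + 2 * (K / T)) - 8 * Z n s)
    (fun s => leaderValue α s - ∑ i, s.cumEst i * u i) (fun n s hs => ?_) T
  · have hend : expect T α ℓ T (fun s => leaderValue α s - ∑ i, s.cumEst i * u i)
        ≤ 48 / (1 - α) * (K * Real.log T) := by
      rw [← expect_const (α := α) S hℓ T (48 / (1 - α) * (K * Real.log T))]
      refine expect_mono S hℓ fun s hs => ?_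
      have h1 := leaderValue_le S (hs.rate_nonneg S) (comparator_mem_openSimplex S a)
      have h2 := regularizer_comparator_le S a (hs.rate_nonneg S)
      unfold ftrlObjective at h1
      linarith
    have hstart := le_leaderValue_start S
    have hcum : ∑ i, (start K α).cumEst i * u i = 0 := by simp [start]
    simp only [expect_sub, expect_const_mul, expect_const S hℓ, Finset.sum_sub_distrib,
      Finset.sum_add_distrib, ← Finset.mul_sum] at htel
    simp only [expect_sub] at hend
    simp only [Finset.sum_const, Finset.card_range, nsmul_eq_mul] at htel
    have hc : (T : ℝ) * (2 * (K / T)) = 2 * K := by field_simp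
    rw [hcum] at htel
    linarith
  · have hr := hs.rate_nonneg S
    have hq := (iterate_spec S hr).1
    have hstep : ∑ i, sampling T α s i * (∑ j, lossEstimate T α s i (ℓ n i) j
          * (iterate α s j - u j) - 8 * (stability T α s i (ℓ n i) / s.rate i))
        ≤ ∑ i, sampling T α s i * ((leaderValue α (update T α s i (ℓ n i))
          - ∑ j, (update T α s i (ℓ n i)).cumEst j * u j)
          - (leaderValue α s - ∑ j, s.cumEst j * u j)) :=
      Finset.sum_le_sum fun i _ => by
        refine mul_le_mul_of_nonneg_left ?_ (sampling_pos S hr i).le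
        have h := leaderValue_add_le S hs i (hℓ n i)
        simp only [update_cumEst, add_mul, mul_sub, Finset.sum_add_distrib,
          Finset.sum_sub_distrib]
        linarith
    refine le_trans ?_ hstep
    -- Unbiasedness turns the mean of the estimates back into the true losses.
    have hlin : ∑ i, sampling T α s i * (∑ j, lossEstimate T α s i (ℓ n i) j
          * (iterate α s j - u j) - 8 * (stability T α s i (ℓ n i) / s.rate i))
        = ∑ j, ℓ n j * (iterate α s j - u j) - 8 * Z n s := by
      simp only [mul_sub, Finset.sum_sub_distrib, hZ, Finset.mul_sum, ← mul_assoc]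
      congr 1
      · have hest : ∀ v : Fin K → ℝ, ∑ i, ∑ j, sampling T α s i
            * lossEstimate T α s i (ℓ n i) j * v j = ∑ j, ℓ n j * v j := fun v => by
          rw [Finset.sum_comm]
          refine Finset.sum_congr rfl fun j _ => ?_
          rw [← Finset.sum_mul, sum_sampling_mul_lossEstimate S hr]
        rw [hest, hest]
      · exact Finset.sum_congr rfl fun i _ => by ring
    rw [hlin]
    have hsumℓ : ∑ i, ℓ n i ≤ K := by
      calc ∑ i, ℓ n i ≤ ∑ _i : Fin K, (1 : ℝ) := Finset.sum_le_sum fun i _ => (hℓ n i).2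
        _ = K := by simp
    have hsumq : 0 ≤ ∑ i, ℓ n i * iterate α s i :=
      Finset.sum_nonneg fun i _ => mul_nonneg (hℓ n i).1 (hq.2 i).le
    have hp : ∑ i, sampling T α s i * ℓ n i
        = (1 - K / T) * ∑ i, ℓ n i * iterate α s i + 1 / T * ∑ i, ℓ n i := by
      unfold sampling
      rw [Finset.mul_sum, Finset.mul_sum, ← Finset.sum_add_distrib]
      exact Finset.sum_congr rfl fun i _ => by ring
    have hu' : ∑ i, ℓ n i * u i = (1 - K / T) * ℓ n a + 1 / T * ∑ i, ℓ n i := by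
      simp only [hu, comparator, mul_add, Finset.sum_add_distrib, ← Finset.sum_mul]
      simp
      ring
    simp only [mul_sub, Finset.sum_sub_distrib]
    rw [hp, hu']
    have h1 : 1 / (T : ℝ) * ∑ i, ℓ n i ≤ K / T := by
      rw [one_div_mul_eq_div]; gcongr
    have h2 : 0 ≤ (K : ℝ) / T * ∑ i, ℓ n i * iterate α s i := mul_nonneg hrat0 hsumq
    have h3 : 0 ≤ (K : ℝ) / T * ℓ n a := mul_nonneg hrat0 (hℓ n a).1
    linarith

/-! ### Stability-penalty matching -/

/-- A round changes only the summand of the drawn arm in a separable potential. -/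
theorem separable_update_sub (F : Fin K → ℝ → ℕ → ℝ → ℝ) (s : CoWSPMState K) (I : Fin K)
    (y : ℝ) :
    ∑ j, F j ((update T α s I y).rate j) ((update T α s I y).count j)
        ((update T α s I y).lossSum j) - ∑ j, F j (s.rate j) (s.count j) (s.lossSum j)
      = F I (s.rate I + stability T α s I y / (s.rate I * penalty T α s I)) (s.count I + 1)
        (s.lossSum I + y) - F I (s.rate I) (s.count I) (s.lossSum I) := by
  rw [← Finset.sum_sub_distrib, Finset.sum_eq_single I]
  · simp [update]
  · intro j _ hj
    simp [update, Ne.symm hj]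
  · simp

/-- The rate grows by at most `12 T` per round and starts at `32` or more, so its final value is at
most `T ^ 2` times the initial one. -/
theorem log_rate_sub_log_start_le (S : Setting K T α) {s : CoWSPMState K}
    (hs : Admissible T α T s) (i : Fin K) :
    Real.log (s.rate i) - Real.log (8 * K / (1 - α)) ≤ 2 * Real.log T := by
  have h1 := S.arms_le_start_rate
  have h2 := hs.rate_le i
  have h3 := S.sixteen_le_cast
  have hr : 0 < s.rate i := by linarith [hs.start_le_rate i]
  rw [← Real.log_div hr.ne' (by linarith), show 2 * Real.log T = Real.log ((T : ℝ) ^ 2) by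
    rw [Real.log_pow]; norm_num]
  refine Real.log_le_log (div_pos hr (by linarith)) ?_
  rw [div_le_iff₀ (by linarith)]
  set b := 8 * (K : ℝ) / (1 - α)
  have h4 : 32 * ((T : ℝ) ^ 2 - 1) ≤ b * ((T : ℝ) ^ 2 - 1) :=
    mul_le_mul_of_nonneg_right h1 (by nlinarith)
  nlinarith

/-- The sum of the stability terms, in logarithmic form, with a free parameter for each arm. -/
theorem sum_stability_le_log (S : Setting K T α) (hℓ : ∀ n i, ℓ n i ∈ Set.Icc (0 : ℝ) 1)
    {μ : Fin K → ℝ} (hμ : ∀ i, 0 < μ i) :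
    ∑ n ∈ Finset.range T, expect T α ℓ n
        (fun s => ∑ i, sampling T α s i * (stability T α s i (ℓ n i) / s.rate i))
      ≤ ∑ n ∈ Finset.range T, expect T α ℓ n
          (fun s => ∑ i, sampling T α s i
            * (μ i * (stability T α s i (ℓ n i) * penalty T α s i)))
        + ∑ i, (1 / (2 * μ i) + 24) * (2 * Real.log T) := by
  have htel := sum_expect_le S hℓ
    (fun n s => (∑ i, sampling T α s i * (stability T α s i (ℓ n i) / s.rate i))
      - ∑ i, sampling T α s i * (μ i * (stability T α s i (ℓ n i) * penalty T α s i)))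
    (fun s => ∑ j, (1 / (2 * μ j) + 24) * Real.log (s.rate j)) (fun n s hs => ?_) T
  · simp only [expect_sub, Finset.sum_sub_distrib] at htel
    have hend : expect T α ℓ T (fun s => ∑ j, (1 / (2 * μ j) + 24) * Real.log (s.rate j))
        - ∑ j, (1 / (2 * μ j) + 24) * Real.log ((start K α).rate j)
        ≤ ∑ i, (1 / (2 * μ i) + 24) * (2 * Real.log T) := by
      rw [← expect_const (α := α) S hℓ T
        (∑ j, (1 / (2 * μ j) + 24) * Real.log ((start K α).rate j)), ← expect_sub,
        ← expect_const (α := α) S hℓ T (∑ i, (1 / (2 * μ i) + 24) * (2 * Real.log T))]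
      refine expect_mono S hℓ fun s hs => ?_
      rw [← Finset.sum_sub_distrib]
      refine Finset.sum_le_sum fun i _ => ?_
      rw [← mul_sub]
      have := hμ i
      exact mul_le_mul_of_nonneg_left (log_rate_sub_log_start_le S hs i) (by positivity)
    linarith
  · have hr := hs.rate_nonneg S
    rw [← Finset.sum_sub_distrib]
    refine Finset.sum_le_sum fun i _ => ?_
    rw [← mul_sub]
    refine mul_le_mul_of_nonneg_left ?_ (sampling_pos S hr i).le
    have h1 := separable_update_sub (T := T) (α := α)
      (fun j β _ _ => (1 / (2 * μ j) + 24) * Real.log β) s i (ℓ n i)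
    rw [h1, ← mul_sub]
    have := spm_log (by linarith [hs.two_le_rate S i]) (stability_nonneg S hr i (ℓ n i))
      (penalty_pos S hr i) (hμ i) (hs.stability_div_rate_le S i (hℓ n i))
    linarith

/-- The sum of the stability terms, in worst-case form. -/
theorem sum_stability_le_worst (S : Setting K T α) (hℓ : ∀ n i, ℓ n i ∈ Set.Icc (0 : ℝ) 1)
    {μ : ℝ} (hμ : 0 < μ) :
    ∑ n ∈ Finset.range T, expect T α ℓ n
        (fun s => ∑ i, sampling T α s i * (stability T α s i (ℓ n i) / s.rate i))
      ≤ ∑ n ∈ Finset.range T, expect T α ℓ n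
          (fun s => ∑ i, sampling T α s i * (μ * stability T α s i (ℓ n i)))
        + K * (2 / (α * μ) + 48 * Real.log T) := by
  have hα := S.pos
  -- The cap at `2 / μ` limits the total increase of the first summand to `2 / (α μ)`, however large
  -- the rate becomes.
  set F : ℝ → ℝ := fun β => 1 / α * min β (2 / μ) + 24 * Real.log β with hF
  have htel := sum_expect_le S hℓ
    (fun n s => (∑ i, sampling T α s i * (stability T α s i (ℓ n i) / s.rate i))
      - ∑ i, sampling T α s i * (μ * stability T α s i (ℓ n i)))
    (fun s => ∑ j, F (s.rate j)) (fun n s hs => ?_) T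
  · simp only [expect_sub, Finset.sum_sub_distrib] at htel
    have hend : expect T α ℓ T (fun s => ∑ j, F (s.rate j)) - ∑ j, F ((start K α).rate j)
        ≤ K * (2 / (α * μ) + 48 * Real.log T) := by
      rw [← expect_const (α := α) S hℓ T (∑ j, F ((start K α).rate j)), ← expect_sub,
        ← expect_const (α := α) S hℓ T (K * (2 / (α * μ) + 48 * Real.log T))]
      refine expect_mono S hℓ fun s hs => ?_
      rw [← Finset.sum_sub_distrib]
      calc ∑ j, (F (s.rate j) - F ((start K α).rate j))
          ≤ ∑ _j : Fin K, (2 / (α * μ) + 48 * Real.log T) :=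
            Finset.sum_le_sum fun i _ => ?_
        _ = _ := by simp; ring
      have h1 := log_rate_sub_log_start_le S hs i
      have h2 : 1 / α * min (s.rate i) (2 / μ) ≤ 1 / α * (2 / μ) :=
        mul_le_mul_of_nonneg_left (min_le_right _ _) (by positivity)
      have h3 : 0 ≤ 1 / α * min (8 * (K : ℝ) / (1 - α)) (2 / μ) := by
        have := S.one_sub_pos
        exact mul_nonneg (by positivity) (le_min (by positivity) (by positivity))
      have h4 : 1 / α * (2 / μ) = 2 / (α * μ) := by field_simp
      simp only [hF, start]
      linarith
    linarith
  · have hr := hs.rate_nonneg S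
    rw [← Finset.sum_sub_distrib]
    refine Finset.sum_le_sum fun i _ => ?_
    rw [← mul_sub]
    refine mul_le_mul_of_nonneg_left ?_ (sampling_pos S hr i).le
    have h1 := separable_update_sub (T := T) (α := α) (fun _ β _ _ => F β) s i (ℓ n i)
    rw [h1]
    have := spm_worst hα (by linarith [hs.two_le_rate S i]) (stability_nonneg S hr i (ℓ n i))
      (penalty_pos S hr i) (penalty_le S hr i) hμ (hs.stability_div_rate_le S i (hℓ n i))
    simp only [hF]
    linarith

/-! ### Bounds for single stability terms -/

section Single

variable {s : CoWSPMState K}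

theorem stability_le_rpow (S : Setting K T α) (hs : ∀ i, 0 ≤ s.rate i) (i : Fin K) (y : ℝ) :
    stability T α s i y
      ≤ (y - prediction s i) ^ 2 * (72 / (1 - α) * sampling T α s i ^ (-α)) := by
  have hp := sampling_pos S hs i
  refine mul_le_mul_of_nonneg_left ((min_le_left _ _).trans ?_) (sq_nonneg _)
  obtain ⟨-, h⟩ := dParam_coeff_bounds S.pos S.lt_one
  have := S.one_sub_pos
  calc _ ≤ 72 / (1 - α) * min (sampling T α s i ^ (-α))
        ((1 - sampling T α s i) / sampling T α s i ^ 2) :=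
        mul_le_mul_of_nonneg_right h (le_min (by positivity)
          (div_nonneg (by linarith [sampling_lt_one S hs i]) (by positivity)))
    _ ≤ _ := mul_le_mul_of_nonneg_left (min_le_left _ _) (by positivity)

theorem stability_le_div_sq (S : Setting K T α) (hs : ∀ i, 0 ≤ s.rate i) (i : Fin K) (y : ℝ) :
    stability T α s i y ≤ (y - prediction s i) ^ 2 *
      (72 / (1 - α) * ((1 - sampling T α s i) / sampling T α s i ^ 2)) := by
  have hp := sampling_pos S hs i
  refine mul_le_mul_of_nonneg_left ((min_le_left _ _).trans ?_) (sq_nonneg _)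
  obtain ⟨-, h⟩ := dParam_coeff_bounds S.pos S.lt_one
  have := S.one_sub_pos
  calc _ ≤ 72 / (1 - α) * min (sampling T α s i ^ (-α))
        ((1 - sampling T α s i) / sampling T α s i ^ 2) :=
        mul_le_mul_of_nonneg_right h (le_min (by positivity)
          (div_nonneg (by linarith [sampling_lt_one S hs i]) (by positivity)))
    _ ≤ _ := mul_le_mul_of_nonneg_left (min_le_right _ _) (by positivity)

/-- The powers `p ^ (-α)` and `p ^ α` cancel; the penalty `h` is chosen for this. -/
theorem stability_mul_penalty_le (S : Setting K T α) (hs : ∀ i, 0 ≤ s.rate i) (i : Fin K)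
    (y : ℝ) :
    stability T α s i y * penalty T α s i
      ≤ 72 / (α * (1 - α)) * (y - prediction s i) ^ 2 := by
  have hp := sampling_pos S hs i
  have hα := S.pos
  have := S.one_sub_pos
  refine (mul_le_mul_of_nonneg_right (stability_le_rpow S hs i y)
    (penalty_pos S hs i).le).trans (le_of_eq ?_)
  unfold penalty
  rw [Real.rpow_neg hp.le]
  have : sampling T α s i ^ α ≠ 0 := (Real.rpow_pos_of_pos hp α).ne'
  field_simp

/-- Used for the optimal arm, whose contribution must vanish as `p → 1`. For `p ≤ 1/2` the factor
`p` is itself at most `2 (1 - p)`; for larger `p` the Shannon entry supplies `1 - p`. -/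
theorem sampling_mul_stability_mul_penalty_le (S : Setting K T α) (hs : ∀ i, 0 ≤ s.rate i)
    (i : Fin K) {y : ℝ} (hy : |y - prediction s i| ≤ 1) :
    sampling T α s i * (stability T α s i y * penalty T α s i)
      ≤ 72 / (α * (1 - α)) * (2 * (1 - sampling T α s i)) := by
  have hα := S.pos
  have hα' := S.one_sub_pos
  have hsq : (y - prediction s i) ^ 2 ≤ 1 := by
    rw [← sq_abs]; exact pow_le_one₀ (abs_nonneg _) hy
  have h1 := stability_le_div_sq S hs i y
  have h2 := stability_mul_penalty_le S hs i y
  have hpen : penalty T α s i = 1 / α * sampling T α s i ^ α := rfl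
  have hp := sampling_pos S hs i
  have hp1 := sampling_lt_one S hs i
  have hpen0 := penalty_pos S hs i
  set p := sampling T α s i
  have hG : 0 < 72 / (α * (1 - α)) := by positivity
  rcases le_total p (1 / 2) with h | h
  · calc p * (stability T α s i y * penalty T α s i)
        ≤ p * (72 / (α * (1 - α)) * 1) := by
          refine mul_le_mul_of_nonneg_left (h2.trans ?_) hp.le
          gcongr
      _ = 72 / (α * (1 - α)) * p := by ring
      _ ≤ _ := by gcongr; linarith
  · have h3 : p ^ α / p ≤ 2 := by
      rw [div_le_iff₀ hp]
      have : p ^ α ≤ 1 := Real.rpow_le_one hp.le hp1.le hα.le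
      linarith
    have h4 : stability T α s i y ≤ 1 * (72 / (1 - α) * ((1 - p) / p ^ 2)) := by
      refine h1.trans (mul_le_mul_of_nonneg_right hsq ?_)
      exact mul_nonneg (by positivity) (div_nonneg (by linarith) (by positivity))
    calc p * (stability T α s i y * penalty T α s i)
        ≤ p * (1 * (72 / (1 - α) * ((1 - p) / p ^ 2)) * penalty T α s i) := by gcongr
      _ = 72 / (α * (1 - α)) * (p ^ α / p * (1 - p)) := by rw [hpen]; field_simp
      _ ≤ _ := by
          refine mul_le_mul_of_nonneg_left ?_ hG.le
          exact mul_le_mul_of_nonneg_right h3 (by linarith)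

theorem sum_sampling_mul_stability_le (S : Setting K T α) {n : ℕ} (hs : Admissible T α n s)
    {y : Fin K → ℝ} (hy : ∀ i, y i ∈ Set.Icc (0 : ℝ) 1) :
    ∑ i, sampling T α s i * stability T α s i (y i) ≤ 72 / (1 - α) * (K : ℝ) ^ α := by
  have hr := hs.rate_nonneg S
  have hα' := S.one_sub_pos
  have h1 := sum_rpow_le (a := 1 - α) hα' (by linarith [S.pos]) (by have := S.arms; omega)
    (sampling_pos S hr) (sum_sampling S hr)
  rw [sub_sub_cancel] at h1
  refine le_trans ?_ (mul_le_mul_of_nonneg_left h1 (by positivity))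
  rw [Finset.mul_sum]
  refine Finset.sum_le_sum fun i _ => ?_
  have hp := sampling_pos S hr i
  have hsq : (y i - prediction s i) ^ 2 ≤ 1 := by
    rw [← sq_abs]; exact pow_le_one₀ (abs_nonneg _) (hs.abs_sub_prediction_le i (hy i))
  calc sampling T α s i * stability T α s i (y i)
      ≤ sampling T α s i * ((y i - prediction s i) ^ 2
        * (72 / (1 - α) * sampling T α s i ^ (-α))) :=
        mul_le_mul_of_nonneg_left (stability_le_rpow S hr i _) hp.le
    _ ≤ sampling T α s i * (1 * (72 / (1 - α) * sampling T α s i ^ (-α))) := by gcongr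
    _ = 72 / (1 - α) * sampling T α s i ^ (1 - α) := by
        rw [sub_eq_add_neg, Real.rpow_add hp, Real.rpow_one]; ring

end Single

/-! ### The error of the optimistic predictions -/

/-- The predictions compete with every fixed vector `c`. -/
theorem sum_sq_sub_prediction_le (S : Setting K T α) (hℓ : ∀ n i, ℓ n i ∈ Set.Icc (0 : ℝ) 1)
    {c : Fin K → ℝ} (hc : ∀ i, c i ∈ Set.Icc (0 : ℝ) 1) :
    ∑ n ∈ Finset.range T, expect T α ℓ n
        (fun s => ∑ i, sampling T α s i * (ℓ n i - prediction s i) ^ 2)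
      ≤ ∑ n ∈ Finset.range T, expect T α ℓ n
          (fun s => ∑ i, sampling T α s i * (ℓ n i - c i) ^ 2) + 2 * (K * Real.log T) := by
  -- The prediction is the running mean with one fictitious observation `1/2`. The potential is the
  -- logarithm of the augmented count minus the weighted squared distance of the mean from `c`; it
  -- starts at `-(c - 1/2) ^ 2 ≥ -1/4`.
  set F : Fin K → ℕ → ℝ → ℝ := fun j k l =>
    Real.log (1 + k) - (1 + k) * (c j - (1 / 2 + l) / (1 + k)) ^ 2 with hF
  have hT := S.sixteen_le_cast
  have htel := sum_expect_le S hℓ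
    (fun n s => (∑ i, sampling T α s i * (ℓ n i - prediction s i) ^ 2)
      - ∑ i, sampling T α s i * (ℓ n i - c i) ^ 2)
    (fun s => ∑ j, F j (s.count j) (s.lossSum j)) (fun n s hs => ?_) T
  · simp only [expect_sub, Finset.sum_sub_distrib] at htel
    have hend : expect T α ℓ T (fun s => ∑ j, F j (s.count j) (s.lossSum j))
        - ∑ j, F j ((start K α).count j) ((start K α).lossSum j) ≤ 2 * (K * Real.log T) := by
      rw [← expect_const (α := α) S hℓ T
        (∑ j, F j ((start K α).count j) ((start K α).lossSum j)), ← expect_sub,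
        ← expect_const (α := α) S hℓ T (2 * (K * Real.log T))]
      refine expect_mono S hℓ fun s hs => ?_
      rw [← Finset.sum_sub_distrib]
      calc ∑ j, (F j (s.count j) (s.lossSum j)
            - F j ((start K α).count j) ((start K α).lossSum j))
          ≤ ∑ _j : Fin K, 2 * Real.log T := Finset.sum_le_sum fun j _ => ?_
        _ = _ := by simp; ring
      have h1 : Real.log (1 + s.count j) ≤ Real.log T + 1 / 16 := by
        have h2 : (s.count j : ℝ) ≤ T := by exact_mod_cast hs.count_le j
        have h3 : Real.log (1 + s.count j) ≤ Real.log (T * (1 + 1 / T)) := by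
          refine Real.log_le_log (by positivity) ?_
          have : (T : ℝ) * (1 + 1 / T) = T + 1 := by
            have := S.cast_pos.ne'
            field_simp
          linarith
        have hT' := S.cast_pos
        rw [Real.log_mul hT'.ne' (by positivity)] at h3
        have h4 := Real.log_le_sub_one_of_pos (by positivity : 0 < 1 + 1 / (T : ℝ))
        have h5 : 1 / (T : ℝ) ≤ 1 / 16 := by gcongr
        linarith
      have h2 : 1 ≤ Real.log T := by
        rw [Real.le_log_iff_exp_le S.cast_pos]
        linarith [Real.exp_one_lt_d9]
      have h3 : 0 ≤ (1 + (s.count j : ℝ)) * (c j - (1 / 2 + s.lossSum j) / (1 + s.count j)) ^ 2 :=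
        by positivity
      have h4 : (c j - 1 / 2) ^ 2 ≤ 1 / 4 := by nlinarith [(hc j).1, (hc j).2]
      simp only [hF, start]
      norm_num
      norm_num at h3 h4
      linarith
    linarith
  · have hr := hs.rate_nonneg S
    rw [← Finset.sum_sub_distrib]
    refine Finset.sum_le_sum fun i _ => ?_
    rw [← mul_sub]
    refine mul_le_mul_of_nonneg_left ?_ (sampling_pos S hr i).le
    have h1 := separable_update_sub (T := T) (α := α) (fun j _ k l => F j k l) s i (ℓ n i)
    rw [h1]
    have habs := hs.abs_sub_prediction_le i (hℓ n i)
    have hsq : (ℓ n i - prediction s i) ^ 2 ≤ 1 := by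
      rw [← sq_abs]; exact pow_le_one₀ (abs_nonneg _) habs
    have hk : (0 : ℝ) < 1 + s.count i := by positivity
    have hpred : prediction s i = (1 / 2 + s.lossSum i) / (1 + s.count i) := rfl
    simp only [hF]
    push_cast
    rw [← hpred]
    have hls : 1 / 2 + s.lossSum i = prediction s i * (1 + s.count i) := by
      rw [hpred]; field_simp
    rw [show 1 / 2 + (s.lossSum i + ℓ n i) = prediction s i * (1 + s.count i) + ℓ n i by linarith]
    set k : ℝ := 1 + s.count i
    rw [show 1 + ((s.count i : ℝ) + 1) = k + 1 by simp only [k]; ring]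
    have hk1 : 0 < k + 1 := by linarith
    have hlog : 1 / (k + 1) ≤ Real.log (k + 1) - Real.log k := by
      rw [← Real.log_div hk1.ne' hk.ne']
      have := Real.one_sub_inv_le_log_of_pos (div_pos hk1 hk)
      refine le_trans (le_of_eq ?_) this
      field_simp
      ring
    set m := prediction s i
    set y := ℓ n i
    -- The identity of the running mean leaves a deficit `(y - m) ^ 2 / (k + 1) ≤ 1 / (k + 1)`,
    -- which the increment of the logarithm covers.
    have hid : (y - c i) ^ 2 + k * (c i - m) ^ 2 - (k + 1) * (c i - (m * k + y) / (k + 1)) ^ 2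
        = (y - m) ^ 2 - (y - m) ^ 2 * (1 / (k + 1)) := by
      field_simp
      ring
    have h2 : (y - m) ^ 2 * (1 / (k + 1)) ≤ 1 * (1 / (k + 1)) :=
      mul_le_mul_of_nonneg_right hsq (by positivity)
    linarith

end

section

/-! ### The adversarial regime -/

open CoWSPM Filter Topology

variable {K T : ℕ} {α : ℝ} {ℓ : ℕ → Fin K → ℝ}

theorem Setting.four_le_factor (S : Setting K T α) : 4 ≤ 1 / (α * (1 - α)) := by
  have := mul_pos S.pos S.one_sub_pos
  rw [le_div_iff₀ this]
  nlinarith [sq_nonneg (2 * α - 1)]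

theorem Setting.one_le_log (S : Setting K T α) : 1 ≤ Real.log T := by
  rw [Real.le_log_iff_exp_le S.cast_pos]
  linarith [Real.exp_one_lt_d9, S.sixteen_le_cast]

theorem Setting.cast_le_rpow (S : Setting K T α) : (K : ℝ) ≤ (K : ℝ) ^ (2 - α) := by
  have h : (1 : ℝ) ≤ K := by linarith [S.four_le_cast]
  simpa using Real.rpow_le_rpow_of_exponent_le h (by linarith [S.lt_one] : (1 : ℝ) ≤ 2 - α)

/-- The constant `384 = 8 · 48` comes from the logarithmic parts of the two matching bounds,
multiplied by the factor `8` of `regret_le_sum_stability`. -/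
theorem lower_order_le (S : Setting K T α) :
    2 * (K : ℝ) + 48 / (1 - α) * (K * Real.log T) + 8 * (K : ℝ) ^ (2 - α) / (α * (1 - α))
        + 384 * (K * Real.log T)
      ≤ 150 * (1 / (α * (1 - α))) * (K * Real.log T + (K : ℝ) ^ (2 - α)) := by
  have hG := S.four_le_factor
  have hα := S.pos
  have hα' := S.one_sub_pos
  have h1 : 48 / (1 - α) ≤ 48 * (1 / (α * (1 - α))) := by
    rw [mul_one_div]
    gcongr
    nlinarith [S.lt_one]
  have h2 := S.cast_le_rpow
  have hk : 0 ≤ K * Real.log T := mul_nonneg (Nat.cast_nonneg _) (by linarith [S.one_le_log])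
  have h3 : 8 * (K : ℝ) ^ (2 - α) / (α * (1 - α))
      = 8 * (1 / (α * (1 - α))) * (K : ℝ) ^ (2 - α) := by ring
  rw [h3]
  set G := 1 / (α * (1 - α))
  have hP : 0 ≤ (K : ℝ) ^ (2 - α) := by positivity
  have h4 := mul_le_mul_of_nonneg_right h1 hk
  have h5 := mul_le_mul_of_nonneg_right hG hk
  have h6 := mul_le_mul_of_nonneg_right hG hP
  nlinarith

theorem regret_le_log (S : Setting K T α) (hℓ : ∀ n i, ℓ n i ∈ Set.Icc (0 : ℝ) 1)
    (a : Fin K) {μ : Fin K → ℝ} (hμ : ∀ i, 0 < μ i) :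
    regretAgainst (coWSPM K T α) (fun t : Fin T => ℓ t) a
      ≤ 150 * (1 / (α * (1 - α))) * (K * Real.log T + (K : ℝ) ^ (2 - α))
        + 8 * ∑ n ∈ Finset.range T, expect T α ℓ n
          (fun s => ∑ i, sampling T α s i
            * (μ i * (stability T α s i (ℓ n i) * penalty T α s i)))
        + 8 * (Real.log T * ∑ i, 1 / μ i) := by
  rw [regretAgainst_eq S hℓ]
  have h1 := regret_le_sum_stability S hℓ a
  have h2 := sum_stability_le_log S hℓ hμ
  have h3 := lower_order_le S
  have h4 : ∑ i, (1 / (2 * μ i) + 24) * (2 * Real.log T)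
      = Real.log T * ∑ i, 1 / μ i + 48 * (K * Real.log T) := by
    rw [Finset.mul_sum]
    have : ∀ i, (1 / (2 * μ i) + 24) * (2 * Real.log T)
        = Real.log T * (1 / μ i) + 48 * Real.log T := fun i => by
      have := (hμ i).ne'
      field_simp
      ring
    simp only [this, Finset.sum_add_distrib]
    simp
    ring
  linarith

/-- The expected squared error of the predictions of the drawn losses. -/
def predictionError (T : ℕ) (α : ℝ) (ℓ : ℕ → Fin K → ℝ) : ℝ :=
  ∑ n ∈ Finset.range T, expect T α ℓ n
    (fun s => ∑ i, sampling T α s i * (ℓ n i - prediction s i) ^ 2)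

theorem regret_le_predictionError (S : Setting K T α)
    (hℓ : ∀ n i, ℓ n i ∈ Set.Icc (0 : ℝ) 1) (a : Fin K) {μ : ℝ} (hμ : 0 < μ) :
    regretAgainst (coWSPM K T α) (fun t : Fin T => ℓ t) a
      ≤ 150 * (1 / (α * (1 - α))) * (K * Real.log T + (K : ℝ) ^ (2 - α))
        + 576 * (1 / (α * (1 - α)) * predictionError T α ℓ * μ) + 8 * (K * Real.log T / μ) := by
  refine (regret_le_log S hℓ a (μ := fun _ => μ) fun _ => hμ).trans ?_
  have h1 : ∑ n ∈ Finset.range T, expect T α ℓ n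
      (fun s => ∑ i, sampling T α s i * (μ * (stability T α s i (ℓ n i) * penalty T α s i)))
      ≤ μ * (72 / (α * (1 - α))) * predictionError T α ℓ := by
    rw [predictionError, Finset.mul_sum]
    refine Finset.sum_le_sum fun n _ => ?_
    rw [← expect_const_mul]
    refine expect_mono S hℓ fun s hs => ?_
    have hr := hs.rate_nonneg S
    rw [Finset.mul_sum]
    refine Finset.sum_le_sum fun i _ => ?_
    calc sampling T α s i * (μ * (stability T α s i (ℓ n i) * penalty T α s i))
        ≤ sampling T α s i * (μ * (72 / (α * (1 - α)) * (ℓ n i - prediction s i) ^ 2)) := by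
          refine mul_le_mul_of_nonneg_left ?_ (sampling_pos S hr i).le
          exact mul_le_mul_of_nonneg_left (stability_mul_penalty_le S hr i _) hμ.le
      _ = _ := by ring
  have h2 : Real.log T * ∑ _i : Fin K, 1 / μ = K * Real.log T / μ := by
    simp; ring
  have h3 : μ * (72 / (α * (1 - α))) * predictionError T α ℓ
      = 72 * (1 / (α * (1 - α)) * predictionError T α ℓ * μ) := by ring
  rw [h2]
  linarith

/-- The witness `μ = √b / √a` balances `a μ` against `b / μ`. -/
theorem exists_mul_eq_sqrt {a b : ℝ} (ha : 0 < a) (hb : 0 < b) :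
    ∃ μ, 0 < μ ∧ a * μ = √(a * b) ∧ b / μ = √(a * b) := by
  have h1 := Real.sqrt_pos.2 ha
  have h2 := Real.sqrt_pos.2 hb
  have h3 := Real.mul_self_sqrt ha.le
  have h4 := Real.mul_self_sqrt hb.le
  refine ⟨√b / √a, by positivity, ?_, ?_⟩
  · rw [Real.sqrt_mul ha.le]
    nth_rewrite 1 [← h3]
    field_simp
  · rw [Real.sqrt_mul ha.le]
    nth_rewrite 1 [← h4]
    field_simp

/-- Solving the self-bounding inequality for the regret. -/
theorem self_bounding {R A E Y k G : ℝ} (hk : 0 < k) (hG : 4 ≤ G) (hR0 : 0 ≤ R) (hY : 0 ≤ Y)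
    (hR : ∀ μ, 0 < μ → R ≤ A + 576 * (G * E * μ) + 8 * (k / μ)) (hE : E ≤ Y + R + 2 * k) :
    R ≤ 2 * A + 400000 * G * (√(k * Y) + k) := by
  have hG0 : 0 < G := by linarith
  -- The tuning uses the upper bound for `E`, which contains `R` itself.
  obtain ⟨μ, hμ, h1, h2⟩ := exists_mul_eq_sqrt (a := G * (Y + R + 2 * k)) (b := k)
    (by positivity) hk
  have h3 := hR μ hμ
  have h4 : G * E * μ ≤ G * (Y + R + 2 * k) * μ := by gcongr
  rw [h1] at h4
  rw [h2] at h3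
  have h5 : √(G * (Y + R + 2 * k) * k) ≤ G * √(k * Y) + √(G * k * R) + 2 * (G * k) := by
    have e1 := Real.sq_sqrt (mul_nonneg hk.le hY)
    have e2 := Real.sq_sqrt (mul_nonneg (mul_nonneg hG0.le hk.le) hR0)
    have e3 := Real.sqrt_nonneg (k * Y)
    have e4 := Real.sqrt_nonneg (G * k * R)
    rw [Real.sqrt_le_left (by positivity)]
    set u := √(k * Y)
    set v := √(G * k * R)
    have e5 : G * (Y + R + 2 * k) * k = G * u ^ 2 + v ^ 2 + 2 * (G * k) * k := by
      rw [e1, e2]; ring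
    rw [e5]
    have e6 : G * u ^ 2 ≤ (G * u) ^ 2 := by
      rw [mul_pow, sq G, mul_assoc]
      exact le_mul_of_one_le_left (by positivity) (by linarith)
    have e7 : 2 * (G * k) * k ≤ (2 * (G * k)) ^ 2 := by
      have : k ≤ G * k := le_mul_of_one_le_left hk.le (by linarith)
      nlinarith [mul_pos hG0 hk]
    have e8 : 0 ≤ G * u * v := by positivity
    have e9 : 0 ≤ G * u * (2 * (G * k)) := by positivity
    have e10 : 0 ≤ v * (2 * (G * k)) := by positivity
    nlinarith
  -- `584 = 576 + 8` collects both occurrences of the root and `170528 = 584 ^ 2 / 2`; AM-GM leaves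
  -- only `R / 2`, to be absorbed.
  have h6 : 584 * √(G * k * R) ≤ R / 2 + 170528 * (G * k) := by
    have e2 : √(G * k * R) = √(G * k) * √R := Real.sqrt_mul (by positivity) _
    have e3 := Real.mul_self_sqrt (by positivity : 0 ≤ G * k)
    have e4 := Real.mul_self_sqrt hR0
    rw [e2]
    nlinarith [sq_nonneg (584 * √(G * k) - √R)]
  have h7 : 0 ≤ G * √(k * Y) := by positivity
  have h8 : 0 ≤ G * k := by positivity
  nlinarith

theorem supNorm_bound (S : Setting K T α) (hℓ : ∀ n i, ℓ n i ∈ Set.Icc (0 : ℝ) 1) :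
    predictionError T α ℓ
      ≤ supVariation (fun t : Fin T => ℓ t) + 2 * (K * Real.log T) := by
  rw [← sub_le_iff_le_add]
  have : Nonempty (Set.Icc (0 : Fin K → ℝ) 1) := ⟨⟨0, le_rfl, zero_le_one⟩⟩
  refine le_ciInf fun m => ?_
  have h := sum_sq_sub_prediction_le S hℓ (c := m) fun i => ⟨m.2.1 i, m.2.2 i⟩
  rw [sub_le_iff_le_add]
  refine h.trans (add_le_add_left ?_ _)
  rw [Fin.sum_univ_eq_sum_range (fun n => ‖ℓ n - m‖ ^ 2)]
  refine Finset.sum_le_sum fun n _ => ?_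
  rw [← expect_const (α := α) S hℓ n (‖ℓ n - m‖ ^ 2)]
  refine expect_mono S hℓ fun s hs => ?_
  have hr := hs.rate_nonneg S
  calc ∑ i, sampling T α s i * (ℓ n i - (m : Fin K → ℝ) i) ^ 2
      ≤ ∑ i, sampling T α s i * ‖ℓ n - m‖ ^ 2 := by
        refine Finset.sum_le_sum fun i _ => ?_
        refine mul_le_mul_of_nonneg_left ?_ (sampling_pos S hr i).le
        rw [← sq_abs]
        exact pow_le_pow_left₀ (abs_nonneg _) (norm_le_pi_norm (ℓ n - (m : Fin K → ℝ)) i) 2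
    _ = _ := by rw [← Finset.sum_mul, sum_sampling S hr, one_mul]

/-- Comparison with `c = 0`: since `ℓ ^ 2 ≤ ℓ`, the comparison error is at most the learner's own
loss, which is the loss of `a` plus the regret. -/
theorem predictionError_le_loss (S : Setting K T α) (hℓ : ∀ n i, ℓ n i ∈ Set.Icc (0 : ℝ) 1)
    (a : Fin K) :
    predictionError T α ℓ ≤ ∑ n ∈ Finset.range T, ℓ n a
      + regretAgainst (coWSPM K T α) (fun t : Fin T => ℓ t) a + 2 * (K * Real.log T) := by
  rw [regretAgainst_eq S hℓ]
  have h := sum_sq_sub_prediction_le S hℓ (c := fun _ => 0) fun _ => ⟨le_rfl, zero_le_one⟩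
  have h2 : ∑ n ∈ Finset.range T, expect T α ℓ n
        (fun s => ∑ i, sampling T α s i * (ℓ n i - 0) ^ 2)
      ≤ ∑ n ∈ Finset.range T, expect T α ℓ n (fun s => ∑ i, sampling T α s i * ℓ n i) :=
    Finset.sum_le_sum fun n _ => expect_mono S hℓ fun s hs => Finset.sum_le_sum fun i _ => by
      refine mul_le_mul_of_nonneg_left ?_ (sampling_pos S (hs.rate_nonneg S) i).le
      nlinarith [(hℓ n i).1, (hℓ n i).2]
  unfold predictionError
  linarith

/-- Comparison with `c = 1`: `(ℓ - 1) ^ 2 ≤ 1 - ℓ`, so the regret enters with a negative sign. -/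
theorem predictionError_le_coLoss (S : Setting K T α)
    (hℓ : ∀ n i, ℓ n i ∈ Set.Icc (0 : ℝ) 1) (a : Fin K) :
    predictionError T α ℓ ≤ T - ∑ n ∈ Finset.range T, ℓ n a
      - regretAgainst (coWSPM K T α) (fun t : Fin T => ℓ t) a + 2 * (K * Real.log T) := by
  rw [regretAgainst_eq S hℓ]
  have h := sum_sq_sub_prediction_le S hℓ (c := fun _ => 1) fun _ => ⟨zero_le_one, le_rfl⟩
  have h2 : ∑ n ∈ Finset.range T, expect T α ℓ n
        (fun s => ∑ i, sampling T α s i * (ℓ n i - 1) ^ 2)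
      ≤ ∑ n ∈ Finset.range T,
        (1 - expect T α ℓ n (fun s => ∑ i, sampling T α s i * ℓ n i)) :=
    Finset.sum_le_sum fun n _ => by
      refine (expect_mono S hℓ (Ψ := fun s => 1 - ∑ i, sampling T α s i * ℓ n i)
        fun s hs => ?_).trans (le_of_eq (by rw [expect_sub, expect_const S hℓ]))
      have hr := hs.rate_nonneg S
      calc ∑ i, sampling T α s i * (ℓ n i - 1) ^ 2
          ≤ ∑ i, sampling T α s i * (1 - ℓ n i) := by
            refine Finset.sum_le_sum fun i _ => ?_
            refine mul_le_mul_of_nonneg_left ?_ (sampling_pos S hr i).le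
            nlinarith [(hℓ n i).1, (hℓ n i).2]
        _ = _ := by
            simp only [mul_sub, mul_one, Finset.sum_sub_distrib, sum_sampling S hr]
  rw [Finset.sum_sub_distrib] at h2
  simp only [Finset.sum_const, Finset.card_range, nsmul_eq_mul, mul_one] at h2
  unfold predictionError
  linarith

theorem regretAgainst_add_loss (S : Setting K T α) (hℓ : ∀ n i, ℓ n i ∈ Set.Icc (0 : ℝ) 1)
    (a b : Fin K) :
    regretAgainst (coWSPM K T α) (fun t : Fin T => ℓ t) a + ∑ n ∈ Finset.range T, ℓ n a
      = regretAgainst (coWSPM K T α) (fun t : Fin T => ℓ t) b + ∑ n ∈ Finset.range T, ℓ n b := by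
  rw [regretAgainst_eq S hℓ, regretAgainst_eq S hℓ]
  ring

/-- The data-dependent regret bound. -/
theorem regret_le_dataDependent (S : Setting K T α)
    (hℓ : ∀ n i, ℓ n i ∈ Set.Icc (0 : ℝ) 1) (a : Fin K) :
    regretAgainst (coWSPM K T α) (fun t : Fin T => ℓ t) a
      ≤ 1000000 / (α * (1 - α)) * (√(K * Real.log T *
          min (supVariation fun t : Fin T => ℓ t) (min (bestArmLoss fun t : Fin T => ℓ t)
            (T - bestArmLoss fun t : Fin T => ℓ t)))
        + K * Real.log T + (K : ℝ) ^ (2 - α)) := by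
  have hK : Nonempty (Fin K) := ⟨⟨0, by have := S.arms; omega⟩⟩
  have hG := S.four_le_factor
  have hk : 0 < K * Real.log T :=
    mul_pos (by linarith [S.four_le_cast]) (by linarith [S.one_le_log])
  have hP : 0 ≤ (K : ℝ) ^ (2 - α) := by positivity
  rw [div_eq_mul_one_div]
  obtain ⟨b, hb⟩ := exists_eq_ciInf_of_finite (f := fun i => ∑ t : Fin T, ℓ t i)
  replace hb : bestArmLoss (fun t : Fin T => ℓ t) = ∑ n ∈ Finset.range T, ℓ n b := by
    rw [← Fin.sum_univ_eq_sum_range (fun n => ℓ n b)]; exact hb.symm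
  -- Loss plus regret does not depend on the arm, so an arm of least loss is the hardest comparator.
  have hab : regretAgainst (coWSPM K T α) (fun t : Fin T => ℓ t) a
      ≤ regretAgainst (coWSPM K T α) (fun t : Fin T => ℓ t) b := by
    have h1 := regretAgainst_add_loss S hℓ a b
    have h2 : bestArmLoss (fun t : Fin T => ℓ t) ≤ ∑ n ∈ Finset.range T, ℓ n a := by
      rw [← Fin.sum_univ_eq_sum_range (fun n => ℓ n a)]
      exact ciInf_le (Set.finite_range _).bddBelow a
    linarith
  refine hab.trans ?_
  have hL0 : 0 ≤ ∑ n ∈ Finset.range T, ℓ n b := Finset.sum_nonneg fun n _ => (hℓ n b).1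
  have hLT : ∑ n ∈ Finset.range T, ℓ n b ≤ T := by
    calc ∑ n ∈ Finset.range T, ℓ n b ≤ ∑ _n ∈ Finset.range T, (1 : ℝ) :=
          Finset.sum_le_sum fun n _ => (hℓ n b).2
      _ = T := by simp
  have hQ0 : 0 ≤ supVariation fun t : Fin T => ℓ t :=
    Real.iInf_nonneg fun m => Finset.sum_nonneg fun _ _ => sq_nonneg _
  have hE1 := supNorm_bound S hℓ
  have hE2 := predictionError_le_loss S hℓ b
  have hE3 := predictionError_le_coLoss S hℓ b
  have hR := fun μ (hμ : 0 < μ) => regret_le_predictionError S hℓ b hμ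
  rw [hb]
  set G := 1 / (α * (1 - α))
  set R := regretAgainst (coWSPM K T α) (fun t : Fin T => ℓ t) b
  set Y := min (supVariation fun t : Fin T => ℓ t) (min (∑ n ∈ Finset.range T, ℓ n b)
    (T - ∑ n ∈ Finset.range T, ℓ n b)) with hY
  have hY0 : 0 ≤ Y := le_min hQ0 (le_min hL0 (by linarith))
  have hs := Real.sqrt_nonneg (K * Real.log T * Y)
  -- For `R ≥ 0` all three bounds on the prediction error weaken to the common form `E ≤ Y + R + 2
  -- k`.
  rcases le_total R 0 with hR0 | hR0
  · exact hR0.trans (by positivity)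
  · have hE : predictionError T α ℓ - R - 2 * (K * Real.log T) ≤ Y :=
      le_min (by linarith) (le_min (by linarith) (by linarith))
    have h := self_bounding hk hG hR0 hY0 hR (by linarith)
    have h1 : 0 ≤ G * √(K * Real.log T * Y) := by positivity
    have h2 : 0 ≤ G * (K * Real.log T) := by positivity
    have h3 : 0 ≤ G * (K : ℝ) ^ (2 - α) := by positivity
    linarith

/-- Split `log T = log (T / K) + log K`. The first part is at most `2 √(T / K)`. The second gives `4
K · K ^ (1/4)`, which is below `K ^ (2 - α)` for `α ≤ 1/2` and below `K ^ (α/2) √(K T)` otherwise.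
-/
theorem arms_mul_log_le (S : Setting K T α) :
    K * Real.log T ≤ 6 * ((K : ℝ) ^ (α / 2) * √(K * T) + (K : ℝ) ^ (2 - α)) := by
  have hK4 := S.four_le_cast
  have hK : (0 : ℝ) < K := by linarith
  have hT := S.cast_pos
  have hα := S.pos
  have hX : 1 ≤ (K : ℝ) ^ (α / 2) := Real.one_le_rpow (by linarith) (by positivity)
  have hsqrt : √((K : ℝ) * T) = K * √(T / K) := by
    rw [show (K : ℝ) * T = K ^ 2 * (T / K) by field_simp, Real.sqrt_mul (by positivity),
      Real.sqrt_sq hK.le]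
  have hratio : 1 ≤ √((T : ℝ) / K) := by
    rw [Real.one_le_sqrt, le_div_iff₀ hK]
    linarith [S.rounds_cast]
  have h1 : Real.log (T / K) ≤ 2 * √(T / K) := by
    have h0 : 0 < (T : ℝ) / K := by positivity
    have := Real.log_le_sub_one_of_pos (Real.sqrt_pos.2 h0)
    rw [Real.log_sqrt h0.le] at this
    linarith
  have h2 : Real.log K ≤ 4 * (K : ℝ) ^ (1 / 4 : ℝ) := by
    have := Real.log_le_rpow_div hK.le (by norm_num : (0 : ℝ) < 1 / 4)
    linarith
  rw [Real.log_div hT.ne' hK.ne'] at h1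
  have h3 : K * Real.log T ≤ 2 * √(K * T) + 4 * (K * (K : ℝ) ^ (1 / 4 : ℝ)) := by
    rw [hsqrt]
    nlinarith
  have h4 : √((K : ℝ) * T) ≤ (K : ℝ) ^ (α / 2) * √(K * T) :=
    le_mul_of_one_le_left (Real.sqrt_nonneg _) hX
  have hP : 0 ≤ (K : ℝ) ^ (2 - α) := by positivity
  have h5 : K * (K : ℝ) ^ (1 / 4 : ℝ) ≤ (K : ℝ) ^ (α / 2) * √(K * T) + (K : ℝ) ^ (2 - α) := by
    rcases le_total α (1 / 2) with h | h
    · have : K * (K : ℝ) ^ (1 / 4 : ℝ) ≤ (K : ℝ) ^ (2 - α) := by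
        nth_rewrite 1 [← Real.rpow_one (K : ℝ)]
        rw [← Real.rpow_add hK]
        exact Real.rpow_le_rpow_of_exponent_le (by linarith) (by linarith)
      have : 0 ≤ (K : ℝ) ^ (α / 2) * √(K * T) := by positivity
      linarith
    · have h6 : (K : ℝ) ^ (1 / 4 : ℝ) ≤ (K : ℝ) ^ (α / 2) :=
        Real.rpow_le_rpow_of_exponent_le (by linarith) (by linarith)
      have h7 : (K : ℝ) ≤ √(K * T) := by
        rw [hsqrt]; exact le_mul_of_one_le_right hK.le hratio
      have h8 : (K : ℝ) ^ (1 / 4 : ℝ) * K ≤ (K : ℝ) ^ (α / 2) * √(K * T) := by gcongr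
      linarith
  linarith

/-- The worst-case regret bound. -/
theorem regret_le_worstCase (S : Setting K T α) (hℓ : ∀ n i, ℓ n i ∈ Set.Icc (0 : ℝ) 1)
    (a : Fin K) :
    regretAgainst (coWSPM K T α) (fun t : Fin T => ℓ t) a
      ≤ 1000000 / (α * (1 - α)) * ((K : ℝ) ^ (α / 2) * √(K * T) + (K : ℝ) ^ (2 - α)) := by
  have hα := S.pos
  have hα' := S.one_sub_pos
  have hG := S.four_le_factor
  have hK : (0 : ℝ) < K := by linarith [S.four_le_cast]
  have hT := S.cast_pos
  -- Balances the stability sum `K ^ α T μ` against the penalty `K / μ`.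
  obtain ⟨μ, hμ, h1, h2⟩ := exists_mul_eq_sqrt (a := (K : ℝ) ^ α * T) (b := K)
    (by positivity) hK
  have hroot : √((K : ℝ) ^ α * T * K) = (K : ℝ) ^ (α / 2) * √(K * T) := by
    rw [show (K : ℝ) ^ α * T * K = (K : ℝ) ^ α * (K * T) by ring,
      Real.sqrt_mul (by positivity), Real.sqrt_eq_rpow ((K : ℝ) ^ α), ← Real.rpow_mul hK.le]
    congr 2
    ring
  rw [hroot] at h1 h2
  have h3 : ∑ n ∈ Finset.range T, expect T α ℓ n
      (fun s => ∑ i, sampling T α s i * (μ * stability T α s i (ℓ n i)))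
      ≤ 72 / (1 - α) * ((K : ℝ) ^ α * T * μ) := by
    calc _ ≤ ∑ _n ∈ Finset.range T, μ * (72 / (1 - α) * (K : ℝ) ^ α) := by
          refine Finset.sum_le_sum fun n _ => ?_
          rw [← expect_const (α := α) S hℓ n (μ * (72 / (1 - α) * (K : ℝ) ^ α))]
          refine expect_mono S hℓ fun s hs => ?_
          refine le_trans (le_of_eq ?_) (mul_le_mul_of_nonneg_left
            (sum_sampling_mul_stability_le S hs (hℓ n)) hμ.le)
          rw [Finset.mul_sum]
          exact Finset.sum_congr rfl fun i _ => by ring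
      _ = _ := by simp; ring
  have h4 := sum_stability_le_worst S hℓ hμ
  have h5 := regret_le_sum_stability S hℓ a
  rw [← regretAgainst_eq S hℓ] at h5
  have h6 := lower_order_le S
  have h7 := arms_mul_log_le S
  have h8 : (K : ℝ) * (2 / (α * μ) + 48 * Real.log T)
      = 2 / α * (K / μ) + 48 * (K * Real.log T) := by
    field_simp
  rw [h8, h2] at h4
  rw [h1] at h3
  have hinv : 1 / (1 - α) ≤ 1 / (α * (1 - α)) := by
    gcongr; nlinarith [S.lt_one]
  have hinv2 : 1 / α ≤ 1 / (α * (1 - α)) := by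
    gcongr; nlinarith
  rw [div_eq_mul_one_div 1000000]
  rw [div_eq_mul_one_div 72] at h3
  rw [div_eq_mul_one_div 2] at h4
  set G := 1 / (α * (1 - α))
  set B := (K : ℝ) ^ (α / 2) * √(K * T)
  have hB : 0 ≤ B := by positivity
  have hP : 0 ≤ (K : ℝ) ^ (2 - α) := by positivity
  have h9 := mul_le_mul_of_nonneg_right hinv hB
  have h10 := mul_le_mul_of_nonneg_right hinv2 hB
  have h11 := mul_le_mul_of_nonneg_left h7 (by linarith : 0 ≤ G)
  have h12 : 0 ≤ G * B := by positivity
  have h13 : 0 ≤ G * (K : ℝ) ^ (2 - α) := by positivity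
  linarith

/-- The losses of the first rounds, continued by zero. -/
def extendLosses (ℓ : Fin T → Fin K → ℝ) (n : ℕ) : Fin K → ℝ :=
  if h : n < T then ℓ ⟨n, h⟩ else 0

theorem extendLosses_coe (ℓ : Fin T → Fin K → ℝ) : (fun t : Fin T => extendLosses ℓ t) = ℓ := by
  ext t
  simp [extendLosses]

theorem extendLosses_mem {ℓ : Fin T → Fin K → ℝ} (hℓ : ∀ t i, ℓ t i ∈ Set.Icc (0 : ℝ) 1) (n : ℕ)
    (i : Fin K) : extendLosses ℓ n i ∈ Set.Icc (0 : ℝ) 1 := by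
  unfold extendLosses
  split_ifs
  · exact hℓ _ i
  · simp

theorem adversarial_bound (S : Setting K T α) {ℓ : Fin T → Fin K → ℝ}
    (hℓ : ∀ t i, ℓ t i ∈ Set.Icc (0 : ℝ) 1) :
    pseudoRegret (coWSPM K T α) ℓ ≤ 1000000 / (α * (1 - α)) *
      min (√(K * Real.log T * min (supVariation ℓ) (min (bestArmLoss ℓ) (T - bestArmLoss ℓ)))
          + K * Real.log T + (K : ℝ) ^ (2 - α))
        ((K : ℝ) ^ (α / 2) * √(K * T) + (K : ℝ) ^ (2 - α)) := by
  have hK : Nonempty (Fin K) := ⟨⟨0, by have := S.arms; omega⟩⟩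
  have hG := S.four_le_factor
  refine ciSup_le fun a => ?_
  have h1 := regret_le_dataDependent S (extendLosses_mem hℓ) a
  have h2 := regret_le_worstCase S (extendLosses_mem hℓ) a
  rw [extendLosses_coe] at h1 h2
  rw [mul_min_of_nonneg _ _ (by rw [div_eq_mul_one_div]; positivity)]
  exact le_min h1 h2

end

section

/-! ### Continuity in the losses -/

open CoWSPM Filter Topology

variable {K T : ℕ} {α : ℝ}

/-- A family of states with positive rates that depends continuously on a parameter. -/
structure ContinuousState {X : Type*} [TopologicalSpace X] (σ : X → CoWSPMState K) : Prop where
  cumEst : ∀ i, Continuous fun x => (σ x).cumEst i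
  rate : ∀ i, Continuous fun x => (σ x).rate i
  count : ∀ i, Continuous fun x => ((σ x).count i : ℝ)
  lossSum : ∀ i, Continuous fun x => (σ x).lossSum i
  rate_pos : ∀ x i, 0 < (σ x).rate i

namespace ContinuousState

variable {X : Type*} [TopologicalSpace X] {σ : X → CoWSPMState K}

theorem prediction (h : ContinuousState σ) (i : Fin K) :
    Continuous fun x => prediction (σ x) i :=
  (continuous_const.add (h.lossSum i)).div (continuous_const.add (h.count i))
    fun _ => by positivity

theorem sampling (S : Setting K T α) (h : ContinuousState σ) (i : Fin K) :
    Continuous fun x => sampling T α (σ x) i := by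
  have hq : Continuous fun x => iterate α (σ x) i :=
    continuous_leader S.two_le S.pos S.lt_one
      (c := fun x i => CoWSPM.prediction (σ x) i + (σ x).cumEst i)
      (fun i => (h.prediction i).add (h.cumEst i)) h.rate (fun x i => (h.rate_pos x i).le) i
  exact (continuous_const.mul hq).add continuous_const

theorem stability (S : Setting K T α) (h : ContinuousState σ) (i : Fin K) {y : X → ℝ}
    (hy : Continuous y) : Continuous fun x => stability T α (σ x) i (y x) := by
  have hp := h.sampling S i
  have hp0 : ∀ x, CoWSPM.sampling T α (σ x) i ≠ 0 := fun x =>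
    (sampling_pos S (fun i => (h.rate_pos x i).le) i).ne'
  refine ((hy.sub (h.prediction i)).pow 2).mul (Continuous.min (continuous_const.mul
    (Continuous.min (hp.rpow_const fun x => Or.inl (hp0 x)) ?_)) ?_)
  · exact (continuous_const.sub hp).div (hp.pow 2) fun x => pow_ne_zero 2 (hp0 x)
  · exact ((h.rate i).mul continuous_const).div_const _

theorem penalty (S : Setting K T α) (h : ContinuousState σ) (i : Fin K) :
    Continuous fun x => penalty T α (σ x) i :=
  continuous_const.mul ((h.sampling S i).rpow_const fun _ => Or.inr S.pos.le)

theorem update (S : Setting K T α) (h : ContinuousState σ) (I : Fin K) {y : X → ℝ}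
    (hy : Continuous y) : ContinuousState fun x => update T α (σ x) I (y x) := by
  have hr : ∀ x i, 0 ≤ (σ x).rate i := fun x i => (h.rate_pos x i).le
  refine ⟨fun i => ?_, fun i => ?_, fun i => ?_, fun i => ?_, fun x i => ?_⟩
  · refine (h.cumEst i).add ((h.prediction i).add ?_)
    split_ifs
    · exact (hy.sub (h.prediction i)).div (h.sampling S i)
        fun x => (sampling_pos S (hr x) i).ne'
    · exact continuous_const
  · refine (h.rate i).add (Continuous.div ?_ ((h.rate i).mul (h.penalty S i))
      fun x => (mul_pos (h.rate_pos x i) (penalty_pos S (hr x) i)).ne')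
    split_ifs
    · exact h.stability S i hy
    · exact continuous_const
  · simp only [CoWSPM.update, Nat.cast_add]
    exact (h.count i).add continuous_const
  · refine (h.lossSum i).add ?_
    split_ifs
    · exact hy
    · exact continuous_const
  · refine add_pos_of_pos_of_nonneg (h.rate_pos x i) (div_nonneg ?_
      (mul_pos (h.rate_pos x i) (penalty_pos S (hr x) i)).le)
    split_ifs
    · exact stability_nonneg S (hr x) i _
    · exact le_rfl

end ContinuousState

section Continuity

variable {X : Type*} [TopologicalSpace X] {n : ℕ} {ℓ : X → Fin n → Fin K → ℝ}

/-- Only positive rates are needed, so this holds for all real losses and not merely on the unit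
cube, which is known to contain them only almost surely. -/
theorem continuousState_state (S : Setting K T α) (hℓ : ∀ t i, Continuous fun x => ℓ x t i)
    (I : Fin n → Fin K) (L : List (Fin n)) :
    ContinuousState fun x => state T α (L.map fun s => (I s, ℓ x s (I s))) := by
  induction L using List.reverseRecOn with
  | nil =>
    refine ⟨fun i => continuous_const, fun i => continuous_const, fun i => ?_,
      fun i => continuous_const, fun x i => ?_⟩
    · change Continuous fun _ : X => (((start K α : CoWSPMState K).count i : ℕ) : ℝ)
      exact continuous_const
    have := S.arms_le_start_rate
    change 0 < 8 * (K : ℝ) / (1 - α)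
    linarith
  | append_singleton L s ih =>
    simp only [List.map_append, List.map_cons, List.map_nil, state_append]
    exact ih.update S (I s) (hℓ s (I s))

theorem continuous_trajProb (S : Setting K T α) (hℓ : ∀ t i, Continuous fun x => ℓ x t i)
    (I : Fin n → Fin K) : Continuous fun x => trajProb (coWSPM K T α) (ℓ x) I :=
  continuous_finsetProd _ fun t _ =>
    (continuousState_state S hℓ I ((List.finRange n).take t)).sampling S (I t)

theorem continuous_expect_sampling (S : Setting K T α) {ℓ : X → ℕ → Fin K → ℝ}
    (hℓ : ∀ t i, Continuous fun x => ℓ x t i) (n : ℕ) (i : Fin K) :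
    Continuous fun x => expect T α (ℓ x) n fun s => sampling T α s i := by
  simp only [← sum_trajProb_mul]
  exact continuous_finsetSum _ fun I _ =>
    (continuous_trajProb (ℓ := fun x (t : Fin n) => ℓ x t) S (fun t i => hℓ t i) I).mul
      ((continuousState_state (ℓ := fun x (t : Fin n) => ℓ x t) S (fun t i => hℓ t i) I
        (List.finRange n)).sampling S i)

end Continuity

theorem continuous_extendLosses (n : ℕ) (i : Fin K) :
    Continuous fun ℓ : Fin T → Fin K → ℝ => extendLosses ℓ n i := by
  unfold extendLosses
  split_ifs
  · fun_prop
  · exact continuous_const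

/-- Expectations after `n` rounds do not depend on later losses. -/
theorem expect_congr_losses {ℓ ℓ' : ℕ → Fin K → ℝ} {n : ℕ} (h : ∀ k < n, ℓ k = ℓ' k)
    (Φ : CoWSPMState K → ℝ) : expect T α ℓ n Φ = expect T α ℓ' n Φ := by
  induction n generalizing Φ with
  | zero => rfl
  | succ n ih =>
    simp only [expect]
    rw [h n n.lt_succ_self]
    exact ih (fun k hk => h k (hk.trans n.lt_succ_self)) _

/-! ### The stochastic regime -/

/-- Under a product measure, a function that does not depend on the coordinate `t` is independent
of that coordinate. -/
theorem integral_pi_mul_eval {ι E : Type*} [Fintype ι] [DecidableEq ι] [MeasurableSpace E]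
    [Inhabited E] (ν : Measure E) [IsProbabilityMeasure ν] (t : ι) {A : (ι → E) → ℝ}
    (hA : Measurable A) (hAt : ∀ ω v, A (Function.update ω t v) = A ω) {g : E → ℝ}
    (hg : Measurable g) :
    ∫ ω, A ω * g (ω t) ∂(Measure.pi fun _ : ι => ν)
      = (∫ ω, A ω ∂(Measure.pi fun _ : ι => ν)) * ∫ x, g x ∂ν := by
  have hind : ProbabilityTheory.iIndepFun (fun (i : ι) (ω : ι → E) => ω i)
      (Measure.pi fun _ : ι => ν) :=
    ProbabilityTheory.iIndepFun_pi (X := fun _ => id) fun _ => aemeasurable_id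
  have hfin := hind.indepFun_finset (Finset.univ.erase t) {t} (by simp) fun i =>
    measurable_pi_apply i
  -- Filling slot `t` with `default` makes `A` a function of the remaining coordinates; `hAt` shows
  -- that this changes nothing.
  have hmeas : Measurable fun r : ↥(Finset.univ.erase t) → E =>
      A fun i => if h : i ∈ Finset.univ.erase t then r ⟨i, h⟩ else default := by
    refine hA.comp (measurable_pi_lambda _ fun i => ?_)
    split_ifs
    · exact measurable_pi_apply _
    · exact measurable_const
  have hgm : Measurable fun r : ↥({t} : Finset ι) → E => g (r ⟨t, by simp⟩) :=
    hg.comp (measurable_pi_apply _)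
  have hcomp := hfin.comp hmeas hgm
  have hA' : ∀ ω : ι → E,
      A (fun i => if i ∈ Finset.univ.erase t then ω i else default) = A ω := fun ω => by
    rw [← hAt ω default]
    congr 1
    ext i
    by_cases h : i = t
    · subst h; simp
    · simp [h]
  have hmul := hcomp.integral_fun_mul_eq_mul_integral
    (hmeas.comp (measurable_pi_lambda _ fun i => measurable_pi_apply _)).aestronglyMeasurable
    (hgm.comp (measurable_pi_lambda _ fun i => measurable_pi_apply _)).aestronglyMeasurable
  simp only [Function.comp_def, dite_eq_ite, hA'] at hmul
  rw [hmul]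
  congr 1
  have := (measurePreserving_eval (fun _ : ι => ν) t).map_eq
  conv_rhs => rw [← this]
  rw [integral_map (measurable_pi_apply t).aemeasurable hg.aestronglyMeasurable]

/-- The bound for a fixed loss sequence with free gaps `D`. -/
theorem regret_le_gaps (S : Setting K T α) {ℓ : ℕ → Fin K → ℝ}
    (hℓ : ∀ n i, ℓ n i ∈ Set.Icc (0 : ℝ) 1) (b : Fin K) {D : Fin K → ℝ}
    (hD : ∀ i, i ≠ b → 0 < D i) (hD1 : ∀ i, D i ≤ 1) (hDb : D b = 0) :
    regretAgainst (coWSPM K T α) (fun t : Fin T => ℓ t) b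
      ≤ 500000 / (α * (1 - α)) * (∑ i ∈ Finset.univ.erase b, Real.log T / D i
          + (K : ℝ) ^ (2 - α))
        + 1 / 2 * ∑ n ∈ Finset.range T, ∑ i,
          D i * expect T α ℓ n (fun s => sampling T α s i) := by
  have hG := S.four_le_factor
  have hlog := S.one_le_log
  have hK4 := S.four_le_cast
  set W := ∑ i ∈ Finset.univ.erase b, 1 / D i with hW
  -- Gaps are at most `1`, so `K - 1 ≤ W`; this absorbs `K log T` into the gap-dependent sum.
  have hKW : (K : ℝ) ≤ 2 * W := by
    have h1 : ∑ _i ∈ Finset.univ.erase b, (1 : ℝ) ≤ W :=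
      Finset.sum_le_sum fun i hi => by
        have := hD i (Finset.ne_of_mem_erase hi)
        rw [le_div_iff₀ this]
        linarith [hD1 i]
    simp only [Finset.sum_const, nsmul_eq_mul, mul_one] at h1
    rw [Finset.card_erase_of_mem (Finset.mem_univ b), Finset.card_univ, Fintype.card_fin,
      Nat.cast_sub (by have := S.arms; omega)] at h1
    push_cast at h1
    linarith
  have hW0 : 0 < W := by linarith
  have hDW : ∀ i, i ≠ b → 1 / W ≤ D i := fun i hi => by
    have h1 := hD i hi
    rw [div_le_iff₀ hW0]
    have h2 : 1 / D i ≤ W :=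
      Finset.single_le_sum (f := fun i => 1 / D i)
        (fun j hj => (one_div_pos.2 (hD j (Finset.ne_of_mem_erase hj))).le)
        (Finset.mem_erase.2 ⟨hi, Finset.mem_univ i⟩)
    rw [div_le_iff₀ h1] at h2
    linarith
  rw [div_eq_mul_one_div]
  have hG72 : 72 / (α * (1 - α)) = 72 * (1 / (α * (1 - α))) := by ring
  have hpen : ∀ s : CoWSPMState K, (∀ i, 0 ≤ s.rate i) → ∀ (i : Fin K) (y : ℝ),
      |y - prediction s i| ≤ 1 → stability T α s i y * penalty T α s i
        ≤ 72 * (1 / (α * (1 - α))) := fun s hs i y hy => by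
    have h1 := stability_mul_penalty_le S hs i y
    rw [hG72] at h1
    refine h1.trans (mul_le_of_le_one_right (by linarith) ?_)
    rw [← sq_abs]
    exact pow_le_one₀ (abs_nonneg _) hy
  have hpen' := fun (s : CoWSPMState K) hs i y hy =>
    sampling_mul_stability_mul_penalty_le (T := T) S (s := s) hs i (y := y) hy
  simp only [hG72] at hpen'
  have hreg := fun μ hμ => regret_le_log S hℓ b (μ := μ) hμ
  set G := 1 / (α * (1 - α))
  have hG0 : 0 < G := by linarith
  -- Chosen so that `(144 + 72) G η = 1/16`; after the factor `8` in `regret_le_log` exactly half of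
  -- `∑ D_i p_i` remains.
  set η := 1 / (3456 * G) with hη
  have hη0 : 0 < η := by positivity
  set μ : Fin K → ℝ := fun i => if i = b then η / W else η * D i with hμdef
  have hμ : ∀ i, 0 < μ i := fun i => by
    simp only [hμdef]
    split_ifs with h
    · positivity
    · exact mul_pos hη0 (hD i h)
  have hμb : μ b = η / W := by simp [hμdef]
  have hμi : ∀ i ∈ Finset.univ.erase b, μ i = η * D i := fun i hi => by
    simp [hμdef, Finset.ne_of_mem_erase hi]
  refine (hreg μ hμ).trans ?_
  have hinv : ∑ i, 1 / μ i = 6912 * G * W := by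
    rw [← Finset.add_sum_erase _ _ (Finset.mem_univ b), hμb,
      Finset.sum_congr rfl fun i hi => by rw [hμi i hi]]
    have : ∀ i, 1 / (η * D i) = 3456 * G * (1 / D i) := fun i => by
      rw [hη]; field_simp
    simp only [this, ← Finset.mul_sum, ← hW]
    rw [hη]
    field_simp
    ring
  have hstep : ∀ n, expect T α ℓ n (fun s => ∑ i, sampling T α s i
        * (μ i * (stability T α s i (ℓ n i) * penalty T α s i)))
      ≤ 1 / 16 * ∑ i, D i * expect T α ℓ n (fun s => sampling T α s i) := fun n => by
    simp only [← expect_const_mul, ← expect_sum]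
    refine expect_mono S hℓ fun s hs => ?_
    have hr := hs.rate_nonneg S
    have hsum := sum_sampling S hr
    rw [← Finset.add_sum_erase _ _ (Finset.mem_univ b)] at hsum
    rw [← Finset.add_sum_erase _ _ (Finset.mem_univ b), Finset.mul_sum,
      ← Finset.add_sum_erase _ (fun i => 1 / 16 * (D i * sampling T α s i)) (Finset.mem_univ b),
      hDb]
    -- For arm `b` the factor `1 - p_b` is spread over the other arms, and `1 / W ≤ D i` turns the
    -- parameter `η / W` into the weights `η D_i`.
    have hb : sampling T α s b * (μ b * (stability T α s b (ℓ n b) * penalty T α s b))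
        ≤ ∑ i ∈ Finset.univ.erase b, 144 * G * η * (D i * sampling T α s i) := by
      have h1 := hpen' s hr b _ (hs.abs_sub_prediction_le b (hℓ n b))
      have h2 := mul_le_mul_of_nonneg_left h1 (hμ b).le
      have h3 : 1 - sampling T α s b = ∑ i ∈ Finset.univ.erase b, sampling T α s i := by
        linarith
      calc _ = μ b * (sampling T α s b * (stability T α s b (ℓ n b) * penalty T α s b)) := by
            ring
        _ ≤ _ := h2
        _ = ∑ i ∈ Finset.univ.erase b, 144 * G * η * (1 / W * sampling T α s i) := by
            rw [h3, hμb, ← Finset.mul_sum, ← Finset.mul_sum]; ring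
        _ ≤ _ := Finset.sum_le_sum fun i hi => by
            have := sampling_pos S hr i
            have := hDW i (Finset.ne_of_mem_erase hi)
            gcongr
    have hi : ∑ i ∈ Finset.univ.erase b, sampling T α s i
          * (μ i * (stability T α s i (ℓ n i) * penalty T α s i))
        ≤ ∑ i ∈ Finset.univ.erase b, 72 * G * η * (D i * sampling T α s i) :=
      Finset.sum_le_sum fun i hi => by
        have h1 := hpen s hr i _ (hs.abs_sub_prediction_le i (hℓ n i))
        have h2 := sampling_pos S hr i
        have h3 := hμ i
        calc _ ≤ sampling T α s i * (μ i * (72 * G)) := by gcongr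
          _ = _ := by rw [hμi i hi]; ring
    have hG16 : 144 * G * η + 72 * G * η = 1 / 16 := by
      rw [hη]; field_simp; norm_num
    refine (add_le_add hb hi).trans (le_of_eq ?_)
    rw [← Finset.sum_add_distrib, zero_mul, mul_zero, zero_add]
    exact Finset.sum_congr rfl fun i _ => by rw [← hG16]; ring
  have hsteps := Finset.sum_le_sum fun n (_ : n ∈ Finset.range T) => hstep n
  rw [← Finset.mul_sum] at hsteps
  have hlogW : ∑ i ∈ Finset.univ.erase b, Real.log T / D i = Real.log T * W := by
    rw [hW, Finset.mul_sum]
    exact Finset.sum_congr rfl fun i _ => by ring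
  rw [hinv, hlogW]
  have hP : 0 ≤ G * (K : ℝ) ^ (2 - α) := by positivity
  have h1 : G * (K * Real.log T) ≤ G * (2 * W * Real.log T) := by gcongr
  have h2 : 0 ≤ G * (Real.log T * W) := by positivity
  linarith

/-- The bound of `regret_le_gaps` holds for each loss sequence with the true gaps inserted as free
numbers. Only after integration does its last sum become the regret, by independence of `p_t` and
`ℓ_t`. -/
theorem stochastic_bound (S : Setting K T α) (ν : Measure (Fin K → ℝ)) [IsProbabilityMeasure ν]
    (hν : ∀ᵐ x ∂ν, ∀ i, x i ∈ Set.Icc (0 : ℝ) 1) (b : Fin K)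
    (hgap : ∀ i, i ≠ b → 0 < gap ν b i) :
    (∀ a, Integrable (fun ℓ : Fin T → Fin K → ℝ => regretAgainst (coWSPM K T α) ℓ a)
      (Measure.pi fun _ : Fin T => ν)) ∧
    stochasticRegret T (coWSPM K T α) ν ≤ 1000000 / (α * (1 - α)) *
      (∑ i ∈ Finset.univ.erase b, Real.log T / gap ν b i + (K : ℝ) ^ (2 - α)) := by
  have hne : Nonempty (Fin K) := ⟨b⟩
  set P := Measure.pi fun _ : Fin T => ν
  have hmem : ∀ᵐ ℓ ∂P, ∀ (t : Fin T) i, ℓ t i ∈ Set.Icc (0 : ℝ) 1 :=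
    ae_all_iff.2 fun t => (Measure.quasiMeasurePreserving_eval (fun _ : Fin T => ν) t).ae hν
  -- the probability of drawing arm `i` in round `t`
  set A : Fin T → Fin K → (Fin T → Fin K → ℝ) → ℝ := fun t i ℓ =>
    expect T α (extendLosses ℓ) t fun s => sampling T α s i
  have hAcont : ∀ t i, Continuous (A t i) := fun t i =>
    continuous_expect_sampling S continuous_extendLosses t i
  have hA01 : ∀ t i ℓ, (∀ t i, ℓ t i ∈ Set.Icc (0 : ℝ) 1) → A t i ℓ ∈ Set.Icc (0 : ℝ) 1 := by
    intro t i ℓ hℓ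
    have hx := extendLosses_mem hℓ
    refine ⟨expect_nonneg S hx fun s hs => (sampling_pos S (hs.rate_nonneg S) i).le, ?_⟩
    rw [← expect_const (T := T) (α := α) S hx t 1]
    exact expect_mono S hx fun s hs => (sampling_lt_one S (hs.rate_nonneg S) i).le
  have hreg : ∀ ℓ : Fin T → Fin K → ℝ, (∀ t i, ℓ t i ∈ Set.Icc (0 : ℝ) 1) → ∀ a,
      regretAgainst (coWSPM K T α) ℓ a = ∑ t, ∑ i, A t i ℓ * (ℓ t i - ℓ t a) := by
    intro ℓ hℓ a
    have hx := extendLosses_mem hℓ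
    have h := regretAgainst_eq S hx a
    rw [extendLosses_coe, ← Finset.sum_sub_distrib, ← Fin.sum_univ_eq_sum_range (fun n =>
      expect T α (extendLosses ℓ) n (fun s => ∑ i, sampling T α s i * extendLosses ℓ n i)
        - extendLosses ℓ n a)] at h
    rw [h]
    refine Finset.sum_congr rfl fun t _ => ?_
    have ht : extendLosses ℓ (t : ℕ) = ℓ t := congrFun (extendLosses_coe ℓ) t
    rw [← expect_const (T := T) (α := α) S hx t (extendLosses ℓ t a), ← expect_sub]
    have hmul : ∀ i, A t i ℓ * (ℓ t i - ℓ t a) = expect T α (extendLosses ℓ) t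
        fun s => (ℓ t i - ℓ t a) * sampling T α s i := fun i => by
      rw [expect_const_mul, mul_comm]
    simp only [hmul, ← expect_sum]
    refine expect_congr S hx fun s hs => ?_
    rw [ht]
    simp only [sub_mul, Finset.sum_sub_distrib, ← Finset.mul_sum,
      sum_sampling S (hs.rate_nonneg S), mul_one]
    congr 1
    exact Finset.sum_congr rfl fun i _ => mul_comm _ _
  have hbdd : ∀ {f : (Fin T → Fin K → ℝ) → ℝ} {M : ℝ}, Continuous f →
      (∀ ℓ, (∀ t i, ℓ t i ∈ Set.Icc (0 : ℝ) 1) → |f ℓ| ≤ M) → Integrable f P := by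
    intro f M hf hM
    refine Integrable.of_bound hf.aestronglyMeasurable M ?_
    filter_upwards [hmem] with ℓ hℓ using hM ℓ hℓ
  have hprod : ∀ t i a ℓ, (∀ t i, ℓ t i ∈ Set.Icc (0 : ℝ) 1) →
      |A t i ℓ * (ℓ t i - ℓ t a)| ≤ 1 := by
    intro t i a ℓ hℓ
    have h1 := hA01 t i ℓ hℓ
    have h2 := hℓ t i
    have h3 := hℓ t a
    rw [abs_mul, abs_of_nonneg h1.1]
    exact mul_le_one₀ h1.2 (abs_nonneg _)
      (abs_le.2 ⟨by linarith [h2.1, h3.2], by linarith [h2.2, h3.1]⟩)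
  have hAint : ∀ t i, Integrable (A t i) P := fun t i =>
    hbdd (hAcont t i) fun ℓ hℓ => by
      rw [abs_of_nonneg (hA01 t i ℓ hℓ).1]; exact (hA01 t i ℓ hℓ).2
  have hprodint : ∀ t i a, Integrable (fun ℓ => A t i ℓ * (ℓ t i - ℓ t a)) P := fun t i a =>
    hbdd ((hAcont t i).mul (by fun_prop)) (hprod t i a)
  have hint : ∀ a, Integrable (fun ℓ : Fin T → Fin K → ℝ =>
      regretAgainst (coWSPM K T α) ℓ a) P := fun a => by
    refine (integrable_finsetSum Finset.univ fun t _ =>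
      integrable_finsetSum Finset.univ fun i _ => hprodint t i a).congr ?_
    filter_upwards [hmem] with ℓ hℓ using (hreg ℓ hℓ a).symm
  refine ⟨hint, ?_⟩
  have hνint : ∀ i, Integrable (fun x : Fin K → ℝ => x i) ν := fun i => by
    refine Integrable.of_bound (measurable_pi_apply i).aestronglyMeasurable 1 ?_
    filter_upwards [hν] with x hx
    rw [Real.norm_eq_abs, abs_of_nonneg (hx i).1]
    exact (hx i).2
  have hgapint : ∀ a i, ∫ x, (x i - x a) ∂ν = gap ν a i := fun a i =>
    integral_sub (hνint i) (hνint a)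
  have hfub : ∀ t i a, ∫ ℓ, A t i ℓ * (ℓ t i - ℓ t a) ∂P = (∫ ℓ, A t i ℓ ∂P) * gap ν a i := by
    intro t i a
    rw [← hgapint]
    refine integral_pi_mul_eval (g := fun x : Fin K → ℝ => x i - x a) ν t
      (hAcont t i).measurable (fun ℓ v => ?_) (by fun_prop)
    -- The draw in round `t` is decided by the losses of strictly earlier rounds, so changing `ℓ t`
    -- has no effect.
    refine expect_congr_losses (fun k hk => ?_) _
    have hkT : k < T := hk.trans t.isLt
    have hkt : (⟨k, hkT⟩ : Fin T) ≠ t := fun h => by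
      rw [← h] at hk; exact lt_irrefl _ hk
    simp [extendLosses, hkT, Function.update_of_ne hkt]
  have hEreg : ∀ a, ∫ ℓ, regretAgainst (coWSPM K T α) ℓ a ∂P
      = ∑ t, ∑ i, (∫ ℓ, A t i ℓ ∂P) * gap ν a i := fun a => by
    rw [integral_congr_ae (g := fun ℓ => ∑ t, ∑ i, A t i ℓ * (ℓ t i - ℓ t a))
      (by filter_upwards [hmem] with ℓ hℓ using hreg ℓ hℓ a),
      integral_finsetSum _ fun t _ => integrable_finsetSum _ fun i _ => hprodint t i a]
    refine Finset.sum_congr rfl fun t _ => ?_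
    rw [integral_finsetSum _ fun i _ => hprodint t i a]
    exact Finset.sum_congr rfl fun i _ => hfub t i a
  have hbb : gap ν b b = 0 := sub_self _
  have hgap0 : ∀ i, 0 ≤ gap ν b i := fun i => by
    by_cases h : i = b
    · rw [h, hbb]
    · exact (hgap i h).le
  have hgap1 : ∀ i, gap ν b i ≤ 1 := fun i => by
    rw [← hgapint]
    calc ∫ x, (x i - x b) ∂ν ≤ ∫ _x, (1 : ℝ) ∂ν := by
          refine integral_mono_ae ((hνint i).sub (hνint b)) (integrable_const 1) ?_
          filter_upwards [hν] with x hx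
          linarith [(hx i).2, (hx b).1]
      _ = 1 := by simp
  -- arm `b` is the best comparator
  have hbest : ∀ a, ∫ ℓ, regretAgainst (coWSPM K T α) ℓ a ∂P
      ≤ ∫ ℓ, regretAgainst (coWSPM K T α) ℓ b ∂P := fun a => by
    rw [hEreg, hEreg]
    refine Finset.sum_le_sum fun t _ => Finset.sum_le_sum fun i _ => ?_
    refine mul_le_mul_of_nonneg_left ?_ (integral_nonneg_of_ae ?_)
    · have := hgap0 a
      unfold gap at *
      linarith
    · filter_upwards [hmem] with ℓ hℓ using (hA01 t i ℓ hℓ).1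
  refine ciSup_le fun a => (hbest a).trans ?_
  set B := 500000 / (α * (1 - α)) *
    (∑ i ∈ Finset.univ.erase b, Real.log T / gap ν b i + (K : ℝ) ^ (2 - α)) with hB
  -- The self-bounding inequality `R ≤ B + R / 2`; it gives `R ≤ 2 B`, whence the constant doubles.
  have hself : ∫ ℓ, regretAgainst (coWSPM K T α) ℓ b ∂P
      ≤ B + 1 / 2 * ∫ ℓ, regretAgainst (coWSPM K T α) ℓ b ∂P := by
    have hsumint : Integrable (fun ℓ => ∑ t, ∑ i, gap ν b i * A t i ℓ) P :=
      integrable_finsetSum _ fun t _ => integrable_finsetSum _ fun i _ =>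
        (hAint t i).const_mul _
    have h1 : ∫ ℓ, regretAgainst (coWSPM K T α) ℓ b ∂P
        ≤ ∫ ℓ, (B + 1 / 2 * ∑ t, ∑ i, gap ν b i * A t i ℓ) ∂P := by
      refine integral_mono_ae (hint b) ((integrable_const B).add (hsumint.const_mul _)) ?_
      filter_upwards [hmem] with ℓ hℓ
      have h := regret_le_gaps S (extendLosses_mem hℓ) b hgap hgap1 hbb
      rw [extendLosses_coe, ← Fin.sum_univ_eq_sum_range (fun n => ∑ i, gap ν b i
        * expect T α (extendLosses ℓ) n (fun s => sampling T α s i))] at h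
      exact h
    refine h1.trans (le_of_eq ?_)
    rw [integral_add (integrable_const B) (hsumint.const_mul _), integral_const_mul (1 / 2 : ℝ), hEreg,
      integral_finsetSum _ fun t _ => integrable_finsetSum _ fun i _ =>
        (hAint t i).const_mul _]
    congr 1
    · simp
    · congr 1
      refine Finset.sum_congr rfl fun t _ => ?_
      rw [integral_finsetSum _ fun i _ => (hAint t i).const_mul _]
      refine Finset.sum_congr rfl fun i _ => ?_
      rw [integral_const_mul, mul_comm]
  have hB2 : 1000000 / (α * (1 - α)) *
    (∑ i ∈ Finset.univ.erase b, Real.log T / gap ν b i + (K : ℝ) ^ (2 - α)) = 2 * B := by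
    rw [hB]; ring
  rw [hB2]
  linarith

end

end Bandit

end

theorem mainTheorem2 :
    ∃ C : ℝ, 0 < C ∧
      ∀ (α : ℝ), 0 < α → α < 1 → ∀ (K T : ℕ), 4 ≤ K → 4 * K ≤ T →
        -- adversarial regime
        (∀ ℓ : Fin T → Fin K → ℝ, (∀ t i, ℓ t i ∈ Set.Icc (0 : ℝ) 1) →
          Bandit.pseudoRegret (Bandit.coWSPM K T α) ℓ ≤
            C / (α * (1 - α)) *
              min
                (√((K : ℝ) * Real.log T *
                    min (Bandit.supVariation ℓ)
                      (min (Bandit.bestArmLoss ℓ) ((T : ℝ) - Bandit.bestArmLoss ℓ)))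
                  + (K : ℝ) * Real.log T + (K : ℝ) ^ (2 - α))
                ((K : ℝ) ^ (α / 2) * √((K : ℝ) * T) + (K : ℝ) ^ (2 - α))) ∧
        -- stochastic regime
        (∀ ν : MeasureTheory.Measure (Fin K → ℝ), MeasureTheory.IsProbabilityMeasure ν →
          (∀ᵐ x ∂ν, ∀ i, x i ∈ Set.Icc (0 : ℝ) 1) →
          ∀ iStar : Fin K, (∀ i, i ≠ iStar → 0 < Bandit.gap ν iStar i) →
            (∀ a, MeasureTheory.Integrable
              (fun ℓ : Fin T → Fin K → ℝ => Bandit.regretAgainst (Bandit.coWSPM K T α) ℓ a)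
              (MeasureTheory.Measure.pi fun _ : Fin T => ν)) ∧
            Bandit.stochasticRegret T (Bandit.coWSPM K T α) ν ≤
              C / (α * (1 - α)) *
                (∑ i ∈ Finset.univ.erase iStar, Real.log T / Bandit.gap ν iStar i
                  + (K : ℝ) ^ (2 - α))) := by
  refine ⟨1000000, by norm_num, fun α hα hα1 K T hK hT => ?_⟩
  have S : Bandit.Setting K T α := ⟨hα, hα1, hK, hT⟩
  exact ⟨fun ℓ hℓ => Bandit.adversarial_bound S hℓ,
    fun ν hν hmem iStar hgap => Bandit.stochastic_bound S ν hmem iStar hgap⟩
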